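/- Let $M$ be a smooth manifold of dimension $n\ge 3$ and let $F$ be a Randers metric on $M$, i.e. a Finsler metric of the form $F=\alpha+\beta$ with $\alpha=\sqrt{a_{ij}(x)y^iy^j}$ given by a smooth Riemannian metric and $\beta=b_i(x)y^i$ a smooth $1$-form. (A Finsler metric is a function $F:TM\to[0,\infty)$, smooth on $TM_0=TM\setminus\{0\}$, positively $1$-homogeneous on the fibres, with $g_{ij}=\tfrac12[F^2]_{y^iy^j}$ positive definite on $TM_0$.) Write $(g^{ij})=(g_{ij})^{-1}$, $C_{ijk}=\tfrac12\,\partial g_{ij}/\partial y^k$ for the Cartan torsion, $G^i=\tfrac14 g^{il}\{[F^2]_{x^ky^l}y^k-[F^2]_{x^l}\}$, and $N^i_k=\partial G^i/\partial y^k$. The horizontal distribution of the Cartan connection of $F$ is spanned by $\delta_k=\partial/\partial x^k-N^m_k\,\partial/\partial y^m$. The Landsberg curvature is $L_{ijk}=C_{ijk|s}y^s$, where the bar denotes here the horizontal covariant derivative of the Cartan connection, whose horizontal coefficients are $\tfrac12 g^{il}(\delta_jg_{lk}+\delta_kg_{jl}-\delta_lg_{jk})$; put $L^i{}_{jk}=g^{il}L_{ljk}$.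 The metric $F$ is a Berwald metric if $\partial^3G^i/\partial y^j\partial y^k\partial y^l=0$ on $TM_0$. Let $\nabla$ be a smooth linear connection on the pulled-back bundle $\pi^*TM$ over $TM_0$, with connection forms $\omega_j{}^i$ ($\nabla\partial_j=\omega_j{}^i\otimes\partial_i$) in natural coordinates $(x^i,y^i)$, such that: (a) $F^k_{ij}y^i=F^k_{ij}y^j=0$, where $\nabla_{\partial/\partial y^i}\partial_j=F^k_{ij}\partial_k$; (b) the horizontal distribution of $\nabla$, i.e. the kernel of $\hat X\mapsto\nabla_{\hat X}(y^j\partial_j)$, is that of the Cartan connection of $F$; (c) the hh-torsion of $\nabla$ vanishes: $\nabla_{\hat X}\rho\hat Y-\nabla_{\hat Y}\rho\hat X-\rho[\hat X,\hat Y]=0$ for all horizontal vector fields $\hat X,\hat Y$ on $TM_0$, where $\rho:T(TM_0)\to\pi^*TM$ is the map induced by $d\pi$; (d) $g_{ij|k}=0$, i.e. $\nabla_{\hat X}g=0$ for all horizontal $\hat X$. Let $\widetilde\nabla$ be the connection obtained from $\nabla$ by Matsumoto's $L$-process, i.e. the connection on $\pi^*TM$ with connection forms $\widetilde\omega_j{}^i=\omega_j{}^i+L^i{}_{jk}\,dx^k$.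 Then the hh-curvatures of $\nabla$ and $\widetilde\nabla$ (the restrictions of their curvatures to horizontal vectors) coincide if and only if $F$ is a Berwald metric. -/

import Mathlib

open scoped Manifold ContDiff Bundle

noncomputable section

namespace FinslerGeom

/-- The coordinate space `ℝⁿ`, which is also the model of an `n`-manifold. -/
abbrev Coord (n : ℕ) : Type := EuclideanSpace ℝ (Fin n)

/-- The coordinate vector `∂ᵢ` of `ℝⁿ`. -/
abbrev basisVec {n : ℕ} (i : Fin n) : Coord n := EuclideanSpace.single i (1 : ℝ)

/-! ### Finsler calculus in natural coordinates

Points of the slit tangent bundle are written `z = (x, y)` in natural coordinates, and `f` is the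
coordinate expression of a Finsler metric. -/

section Local

variable {n : ℕ}

/-- `∂φ/∂xⁱ`. -/
def dx (i : Fin n) (φ : Coord n × Coord n → ℝ) (z : Coord n × Coord n) : ℝ :=
  fderiv ℝ φ z (basisVec i, 0)

/-- `∂φ/∂yⁱ`. -/
def dy (i : Fin n) (φ : Coord n × Coord n → ℝ) (z : Coord n × Coord n) : ℝ :=
  fderiv ℝ φ z (0, basisVec i)

/-- `F²`. -/
def energy (f : Coord n × Coord n → ℝ) (z : Coord n × Coord n) : ℝ := f z ^ 2

/-- The fundamental tensor `g_ij = ½ [F²]_{yⁱ yʲ}`. -/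
def fundTensor (f : Coord n × Coord n → ℝ) (i j : Fin n) (z : Coord n × Coord n) : ℝ :=
  (1 / 2) * dy i (dy j (energy f)) z

/-- The matrix `(g_ij)` at a point. -/
def fundMatrix (f : Coord n × Coord n → ℝ) (z : Coord n × Coord n) : Matrix (Fin n) (Fin n) ℝ :=
  Matrix.of fun i j => fundTensor f i j z

/-- The inverse `gⁱʲ` of the fundamental tensor. -/
def fundInv (f : Coord n × Coord n → ℝ) (i j : Fin n) (z : Coord n × Coord n) : ℝ :=
  (fundMatrix f z)⁻¹ i j

/-- The Cartan torsion `C_ijk = ½ ∂g_ij/∂yᵏ`. -/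
def cartanTorsion (f : Coord n × Coord n → ℝ) (i j k : Fin n) (z : Coord n × Coord n) : ℝ :=
  (1 / 2) * dy k (fundTensor f i j) z

/-- The spray coefficients `Gⁱ = ¼ gⁱˡ ([F²]_{xᵏ yˡ} yᵏ - [F²]_{xˡ})`. -/
def sprayCoeff (f : Coord n × Coord n → ℝ) (i : Fin n) (z : Coord n × Coord n) : ℝ :=
  (1 / 4) * ∑ l, fundInv f i l z *
    ((∑ k, dx k (dy l (energy f)) z * z.2 k) - dx l (energy f) z)

/-- The coefficients `Nⁱ_k = ∂Gⁱ/∂yᵏ` of the nonlinear connection whose horizontal distribution,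
spanned by `δ/δxᵏ = ∂/∂xᵏ - Nᵐ_k ∂/∂yᵐ`, is the one of the Cartan connection. -/
def nonlinCoeff (f : Coord n × Coord n → ℝ) (i k : Fin n) (z : Coord n × Coord n) : ℝ :=
  dy k (sprayCoeff f i) z

/-- `δφ/δxᵏ = ∂φ/∂xᵏ - Nᵐ_k ∂φ/∂yᵐ`. -/
def hDeriv (f : Coord n × Coord n → ℝ) (k : Fin n) (φ : Coord n × Coord n → ℝ)
    (z : Coord n × Coord n) : ℝ :=
  dx k φ z - ∑ m, nonlinCoeff f m k z * dy m φ z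

/-- The horizontal coefficients of the Cartan connection,
`Γⁱ_jk = ½ gⁱˡ (δg_lk/δxʲ + δg_jl/δxᵏ - δg_jk/δxˡ)`. -/
def cartanGamma (f : Coord n × Coord n → ℝ) (i j k : Fin n) (z : Coord n × Coord n) : ℝ :=
  (1 / 2) * ∑ l, fundInv f i l z *
    (hDeriv f j (fundTensor f l k) z + hDeriv f k (fundTensor f j l) z
      - hDeriv f l (fundTensor f j k) z)

/-- The horizontal covariant derivative `C_{ijk|s}` of the Cartan torsion with respect to the Cartan
connection. -/
def cartanTorsionH (f : Coord n × Coord n → ℝ) (i j k s : Fin n) (z : Coord n × Coord n) : ℝ :=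
  hDeriv f s (cartanTorsion f i j k) z - ∑ m, (cartanGamma f m i s z * cartanTorsion f m j k z
    + cartanGamma f m j s z * cartanTorsion f i m k z
    + cartanGamma f m k s z * cartanTorsion f i j m z)

/-- The Landsberg curvature `L_ijk = C_{ijk|s} yˢ`. -/
def landsberg (f : Coord n × Coord n → ℝ) (i j k : Fin n) (z : Coord n × Coord n) : ℝ :=
  ∑ s, cartanTorsionH f i j k s z * z.2 s

/-- `Lⁱ_jk = gⁱˡ L_ljk`. -/
def landsbergUp (f : Coord n × Coord n → ℝ) (i j k : Fin n) (z : Coord n × Coord n) : ℝ :=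
  ∑ l, fundInv f i l z * landsberg f l j k z

/-- The Berwald curvature `Bⁱ_jkl = ∂³Gⁱ/∂yʲ∂yᵏ∂yˡ`. -/
def berwaldCurv (f : Coord n × Coord n → ℝ) (i j k l : Fin n) (z : Coord n × Coord n) : ℝ :=
  dy l (dy k (dy j (sprayCoeff f i))) z

end Local

/-! ### Manifolds, natural coordinates, Finsler and Randers metrics -/

section Global

variable {n : ℕ} {M : Type*} [TopologicalSpace M] [ChartedSpace (Coord n) M]

/-- The slit tangent bundle `TM₀`, as a set of tangent vectors. -/
def slit (n : ℕ) (M : Type*) [TopologicalSpace M] [ChartedSpace (Coord n) M]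
    [IsManifold (𝓡 n) ∞ M] : Set (TangentBundle (𝓡 n) M) := {z | z.2 ≠ 0}

/-- The smooth charts of `M`. -/
abbrev charts (n : ℕ) (M : Type*) [TopologicalSpace M] [ChartedSpace (Coord n) M] :
    Set (OpenPartialHomeomorph M (Coord n)) := IsManifold.maximalAtlas (𝓡 n) ∞ M

/-- The tangent vector `vʲ ∂/∂xʲ` at `p`, for the coordinates `x` of the chart `e` around `p`. -/
def coordVec (e : OpenPartialHomeomorph M (Coord n)) (p : M) (v : Coord n) :
    TangentSpace (𝓡 n) p :=
  (mfderiv (𝓡 n) 𝓘(ℝ, Coord n) e p).inverse v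

/-- The point `yʲ ∂/∂xʲ|_x` of `TM` with natural coordinates `z = (x, y)`. -/
def natPoint (e : OpenPartialHomeomorph M (Coord n)) (z : Coord n × Coord n) :
    TangentBundle (𝓡 n) M :=
  ⟨e.symm z.1, coordVec e (e.symm z.1) z.2⟩

/-- The range of the natural coordinates `(x, y)` on the part of `TM₀` over the domain of `e`. -/
def natDomain (e : OpenPartialHomeomorph M (Coord n)) : Set (Coord n × Coord n) :=
  {z | z.1 ∈ e.target ∧ z.2 ≠ 0}

/-- The coordinate expression `F(x, y)` of a function on `TM`. -/
def inChart (F : TangentBundle (𝓡 n) M → ℝ) (e : OpenPartialHomeomorph M (Coord n)) :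
    Coord n × Coord n → ℝ := fun z => F (natPoint e z)

variable [IsManifold (𝓡 n) ∞ M]

/-- `F` is a Finsler metric on `M`. -/
structure IsFinslerMetric (F : TangentBundle (𝓡 n) M → ℝ) : Prop where
  nonneg : ∀ z, 0 ≤ F z
  smooth : ContMDiffOn (𝓡 n).tangent 𝓘(ℝ, ℝ) ∞ F (slit n M)
  homogeneous : ∀ (p : M) (y : TangentSpace (𝓡 n) p) (c : ℝ), 0 < c → F ⟨p, c • y⟩ = c * F ⟨p, y⟩
  posDef : ∀ e ∈ charts n M, ∀ z ∈ natDomain e, (fundMatrix (inChart F e) z).PosDef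

/-- `F` is a Randers metric: a Finsler metric of the form `F = α + β`, where
`α = √(a_ij(x) yⁱ yʲ)` comes from a Riemannian metric and `β = b_i(x) yⁱ` is a smooth `1`-form. -/
def IsRanders (F : TangentBundle (𝓡 n) M → ℝ) : Prop :=
  IsFinslerMetric F ∧
    ∃ (a : Bundle.ContMDiffRiemannianMetric (𝓡 n) ∞ (Coord n)
        (fun p : M => TangentSpace (𝓡 n) p))
      (β : ∀ p : M, TangentSpace (𝓡 n) p →L[ℝ] ℝ),
      ContMDiff (𝓡 n).tangent 𝓘(ℝ, ℝ) ∞ (fun z : TangentBundle (𝓡 n) M => β z.1 z.2) ∧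
      ∀ z : TangentBundle (𝓡 n) M, F z = √(a.inner z.1 z.2 z.2) + β z.1 z.2

/-- `F` is a Berwald metric: its Berwald curvature vanishes. -/
def IsBerwald (F : TangentBundle (𝓡 n) M → ℝ) : Prop :=
  ∀ e ∈ charts n M, ∀ z ∈ natDomain e, ∀ i j k l, berwaldCurv (inChart F e) i j k l z = 0

/-! ### Connections on `π*TM` -/

/-- The projection `π : TM → M`. -/
def proj (n : ℕ) (M : Type*) [TopologicalSpace M] [ChartedSpace (Coord n) M]
    [IsManifold (𝓡 n) ∞ M] : C(TangentBundle (𝓡 n) M, M) :=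
  ⟨fun z => z.proj, FiberBundle.continuous_proj (Coord n) (TangentSpace (𝓡 n))⟩

/-- The pulled-back bundle `π*TM` over `TM`; its fibre at `z` is `T_{π z} M`. -/
abbrev PullTM (n : ℕ) (M : Type*) [TopologicalSpace M] [ChartedSpace (Coord n) M]
    [IsManifold (𝓡 n) ∞ M] : TangentBundle (𝓡 n) M → Type :=
  (proj n M) *ᵖ (fun p : M => TangentSpace (𝓡 n) p)

instance instAddCommGroupPullTM (z : TangentBundle (𝓡 n) M) : AddCommGroup (PullTM n M z) :=
  inferInstanceAs (AddCommGroup (TangentSpace (𝓡 n) z.proj))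

instance instIsTopologicalAddGroupPullTM (z : TangentBundle (𝓡 n) M) :
    IsTopologicalAddGroup (PullTM n M z) :=
  inferInstanceAs (IsTopologicalAddGroup (TangentSpace (𝓡 n) z.proj))

instance instContinuousSMulPullTM (z : TangentBundle (𝓡 n) M) : ContinuousSMul ℝ (PullTM n M z) :=
  inferInstanceAs (ContinuousSMul ℝ (TangentSpace (𝓡 n) z.proj))

/-- The type of the operator `Y ↦ (X ↦ ∇_X Y)`, from sections `Y` of `π*TM` to `π*TM`-valued
`1`-forms on `TM`. -/
abbrev CovOp (n : ℕ) (M : Type*) [TopologicalSpace M] [ChartedSpace (Coord n) M]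
    [IsManifold (𝓡 n) ∞ M] :=
  (∀ z : TangentBundle (𝓡 n) M, PullTM n M z) →
    ∀ z : TangentBundle (𝓡 n) M, TangentSpace (𝓡 n).tangent z →L[ℝ] PullTM n M z

/-- The natural frame field `∂_j` of `π*TM` over the domain of `e`. -/
def natFrame (e : OpenPartialHomeomorph M (Coord n)) (j : Fin n)
    (z : TangentBundle (𝓡 n) M) : PullTM n M z :=
  coordVec e z.proj (basisVec j)

/-- The `k`-th component of an element of the fibre of `π*TM` at `w` in the natural frame. -/
def natComp (e : OpenPartialHomeomorph M (Coord n)) (k : Fin n) (w : TangentBundle (𝓡 n) M)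
    (v : PullTM n M w) : ℝ :=
  (show Coord n from mfderiv (𝓡 n) 𝓘(ℝ, Coord n) e w.proj v) k

/-- The tangent vector `X.1ⁱ ∂/∂xⁱ + X.2ⁱ ∂/∂yⁱ` of `TM` at the point with natural coordinates `z`. -/
def natVec (e : OpenPartialHomeomorph M (Coord n)) (z X : Coord n × Coord n) :
    TangentSpace (𝓡 n).tangent (natPoint e z) :=
  mfderiv 𝓘(ℝ, Coord n × Coord n) (𝓡 n).tangent (natPoint e) z X

/-- The connection forms `ω_j^k = Γ^k_ij dxⁱ + F^k_ij dyⁱ` in natural coordinates, at `z` and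
evaluated on `X`: the components of `∇_X ∂_j = ω_j^k(X) ∂_k`. -/
def connForm (D : CovOp n M) (e : OpenPartialHomeomorph M (Coord n)) (j k : Fin n)
    (z X : Coord n × Coord n) : ℝ :=
  natComp e k (natPoint e z) (D (natFrame e j) (natPoint e z) (natVec e z X))

/-- A (smooth, linear) connection on the bundle `π*TM` over `TM₀`. Its values outside `TM₀` are
irrelevant. Smoothness means that the connection forms have smooth coefficients. -/
structure PullConnection (n : ℕ) (M : Type*) [TopologicalSpace M] [ChartedSpace (Coord n) M]
    [IsManifold (𝓡 n) ∞ M] where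
  toFun : CovOp n M
  isCov : IsCovariantDerivativeOn (I := (𝓡 n).tangent) (Coord n) toFun (slit n M)
  smooth : ∀ e ∈ charts n M, ∀ (j k : Fin n) (X : Coord n × Coord n),
    ContDiffOn ℝ ∞ (fun z => connForm toFun e j k z X) (natDomain e)

namespace PullConnection

/-- The connection forms `ω_j^k` of `∇`. -/
def form (D : PullConnection n M) (e : OpenPartialHomeomorph M (Coord n)) (j k : Fin n)
    (z X : Coord n × Coord n) : ℝ :=
  connForm D.toFun e j k z X

/-- The components of `μ(X) = ∇_X y`, where `y = yʲ ∂_j = Fℓ` is the tautological section: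
`μⁱ = dyⁱ + yʲ ω_jⁱ`. -/
def mu (D : PullConnection n M) (e : OpenPartialHomeomorph M (Coord n)) (i : Fin n)
    (z X : Coord n × Coord n) : ℝ :=
  X.2 i + ∑ j, z.2 j * D.form e j i z X

/-- `X` is horizontal for `∇`, that is `μ(X) = 0`. -/
def IsHorizontal (D : PullConnection n M) (e : OpenPartialHomeomorph M (Coord n))
    (z X : Coord n × Coord n) : Prop :=
  ∀ i, D.mu e i z X = 0

/-- The torsion `𝒯(X, Y) = ∇_X ρY - ∇_Y ρX - ρ[X, Y]` in components, where `ρX = X.1ʲ ∂_j`: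
it equals `dωⁱ - ωʲ ∧ ω_jⁱ` for the coframe `ωⁱ = dxⁱ`. -/
def torsion (D : PullConnection n M) (e : OpenPartialHomeomorph M (Coord n)) (i : Fin n)
    (z X Y : Coord n × Coord n) : ℝ :=
  ∑ j, (Y.1 j * D.form e j i z X - X.1 j * D.form e j i z Y)

/-- The curvature forms `Ω_j^i = dω_j^i - ω_j^k ∧ ω_k^i`, that is the components of
`Ω(X, Y)∂_j = Ω_j^i(X, Y) ∂_i`. -/
def curvature (D : PullConnection n M) (e : OpenPartialHomeomorph M (Coord n)) (j i : Fin n)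
    (z X Y : Coord n × Coord n) : ℝ :=
  fderiv ℝ (fun w => D.form e j i w Y) z X - fderiv ℝ (fun w => D.form e j i w X) z Y
    - ∑ k, (D.form e j k z X * D.form e k i z Y - D.form e j k z Y * D.form e k i z X)

/-- The two conditions `F^k_ij yⁱ = 0` and `F^k_ij yʲ = 0` on the vertical coefficients
`F^k_ij = ω_j^k(∂/∂yⁱ)`. The second one says that `μ(∂/∂yⁱ) = ∂_i`; in particular `μ` maps the
vertical space isomorphically onto the fibre, so that `∇` is a Finsler connection. -/
def IsRegular (D : PullConnection n M) : Prop :=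
  ∀ e ∈ charts n M, ∀ z ∈ natDomain e,
    (∀ j k, ∑ i, D.form e j k z (0, basisVec i) * z.2 i = 0) ∧
    (∀ i k, ∑ j, D.form e j k z (0, basisVec i) * z.2 j = 0)

/-- The horizontal distribution of `∇` is the one of the Cartan connection of `F`. -/
def HasCartanHorizontal (D : PullConnection n M) (F : TangentBundle (𝓡 n) M → ℝ) : Prop :=
  ∀ e ∈ charts n M, ∀ z ∈ natDomain e, ∀ X : Coord n × Coord n,
    D.IsHorizontal e z X ↔ ∀ i, X.2 i = -∑ k, nonlinCoeff (inChart F e) i k z * X.1 k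

/-- The hh-torsion of `∇` vanishes: `𝒯(X, Y) = 0` for horizontal `X`, `Y`. -/
def HHTorsionFree (D : PullConnection n M) : Prop :=
  ∀ e ∈ charts n M, ∀ z ∈ natDomain e, ∀ X Y : Coord n × Coord n,
    D.IsHorizontal e z X → D.IsHorizontal e z Y → ∀ i, D.torsion e i z X Y = 0

/-- `g_{ij|k} = 0`: the covariant derivative `∇_X g` of the fundamental tensor `g` of `F` vanishes
for horizontal `X`. -/
def HMetrical (D : PullConnection n M) (F : TangentBundle (𝓡 n) M → ℝ) : Prop :=
  ∀ e ∈ charts n M, ∀ z ∈ natDomain e, ∀ X : Coord n × Coord n, D.IsHorizontal e z X →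
    ∀ i j, fderiv ℝ (fundTensor (inChart F e) i j) z X
      - ∑ m, (D.form e i m z X * fundTensor (inChart F e) m j z
        + D.form e j m z X * fundTensor (inChart F e) i m z) = 0

/-- `D'` is obtained from `D` by Matsumoto's `L`-process: `ω'_jⁱ = ω_jⁱ + Lⁱ_jk dxᵏ`. -/
def IsMatsumotoL (D D' : PullConnection n M) (F : TangentBundle (𝓡 n) M → ℝ) : Prop :=
  ∀ e ∈ charts n M, ∀ z ∈ natDomain e, ∀ (X : Coord n × Coord n) (i j : Fin n),
    D'.form e j i z X = D.form e j i z X + ∑ k, landsbergUp (inChart F e) i j k z * X.1 k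

/-- The hh-curvatures of `D` and `D'` coincide. The hh-curvature `R(u, v)` is `Ω(X, Y)` for the
horizontal lifts `X`, `Y` of `u`, `v` with respect to the connection in question. -/
def SameHHCurvature (D D' : PullConnection n M) : Prop :=
  ∀ e ∈ charts n M, ∀ z ∈ natDomain e, ∀ X Y X' Y' : Coord n × Coord n,
    D.IsHorizontal e z X → D.IsHorizontal e z Y →
    D'.IsHorizontal e z X' → D'.IsHorizontal e z Y' →
    X'.1 = X.1 → Y'.1 = Y.1 →
    ∀ i j, D'.curvature e j i z X' Y' = D.curvature e j i z X Y

end PullConnection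

end Global

end FinslerGeom

end

/-!
# The `L`-process and Berwald metrics among Randers metrics

Everything is computed in natural coordinates `z = (x, y)` on the slit tangent bundle. Subscripts
denote vertical derivatives and `E = F²`.

*The `L`-process.* The connection forms change by `Lⁱ_jk dxᵏ`, and `Lⁱ_jk yʲ = 0`, so that the
horizontal distribution does not change. In the difference of the two hh-curvatures, with its upper
index lowered, the part linear in `L` is symmetric, because `g` is horizontally parallel and `L_ijk`
is symmetric, while the quadratic part is antisymmetric. Equality of the curvatures therefore says
that the matrices `L_ijk ξᵏ` commute with respect to `g` (`mul_comm_of_curvature_eq`,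
`PullConnection.IsMatsumotoL.landsbergForm_comm`).

*Any Finsler metric* satisfies `L_ijk = -½ y_m Bᵐ_ijk`, where `B` is the Berwald curvature
(`IsLocalFinsler.landsberg_eq`). For a Berwald metric the `L`-process is thus trivial, which is one
implication.

*Randers metrics.* For `F = α + β` the spray is `Gᵐ = G_αᵐ + P yᵐ + α sᵐ₀`, where
`2 F P = r₀₀ - 2 α s₀`, and `r₀₀`, `sᵐ₀`, `s₀` are polynomials in `y` built from the symmetric and
antisymmetric parts of the covariant derivative of `β` (`IsRandersPair.spray_eq`). Hence
`L_ijk = ½ (h_ij u_k + h_ik u_j + h_jk u_i)`, with the angular metric `h_ij = F α_ij` and the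
covector `u_k = P_k - P α_k / α + s_k₀ / α` (`IsRandersPair.landsberg_eq`). Matrices of this form
commute only if `u = 0`, as `n ≥ 3` (`eq_zero_of_commute`).

*The case `u = 0`.* The relation `α P_k - P α_k = -s_k₀`, differentiated and antisymmetrized, gives
`s_jk = α_j P_k - α_k P_j`. As `n ≥ 3` there is `y ≠ 0` orthogonal to `∂_j` and `∂_k`, where
`α_j = α_k = 0`; so `s = 0` (`IsRandersPair.randersS_eq_zero`). Then `P / α` is constant along the
fibres, and comparing the even function `r₀₀ = 2 (α + β) P` at `y` and `-y` yields `β P = 0`. Where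
`P ≠ 0` the form `β` vanishes locally, hence so do `r₀₀` and `P`; thus `P = 0` and `G = G_α` is
quadratic in `y`: the metric is a Berwald metric (`IsRandersPair.berwald_eq_zero`).
-/

noncomputable section

namespace FinslerGeom

/-! ### Partial derivatives of smooth functions of `(x, y)` -/

section Calculus

variable {n : ℕ} {Ω : Set (Coord n × Coord n)} {φ ψ : Coord n × Coord n → ℝ}
  {z : Coord n × Coord n}

theorem differentiableAt_of_contDiffOn (hΩ : IsOpen Ω) (hφ : ContDiffOn ℝ ∞ φ Ω) (hz : z ∈ Ω) :
    DifferentiableAt ℝ φ z :=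
  (hφ.contDiffAt (hΩ.mem_nhds hz)).differentiableAt (by simp)

theorem contDiffOn_fderiv_apply (hΩ : IsOpen Ω) (hφ : ContDiffOn ℝ ∞ φ Ω)
    (v : Coord n × Coord n) : ContDiffOn ℝ ∞ (fun z => fderiv ℝ φ z v) Ω :=
  (hφ.fderiv_of_isOpen hΩ (by simp)).clm_apply contDiffOn_const

theorem contDiffOn_dx (hΩ : IsOpen Ω) (hφ : ContDiffOn ℝ ∞ φ Ω) (i : Fin n) :
    ContDiffOn ℝ ∞ (dx i φ) Ω := contDiffOn_fderiv_apply hΩ hφ _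

theorem contDiffOn_dy (hΩ : IsOpen Ω) (hφ : ContDiffOn ℝ ∞ φ Ω) (i : Fin n) :
    ContDiffOn ℝ ∞ (dy i φ) Ω := contDiffOn_fderiv_apply hΩ hφ _

theorem fderiv_congr_of_eqOn (hΩ : IsOpen Ω) (h : Set.EqOn φ ψ Ω) (hz : z ∈ Ω) :
    fderiv ℝ φ z = fderiv ℝ ψ z :=
  (h.eventuallyEq_of_mem (hΩ.mem_nhds hz)).fderiv_eq

theorem eqOn_dx (hΩ : IsOpen Ω) (h : Set.EqOn φ ψ Ω) (i : Fin n) :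
    Set.EqOn (dx i φ) (dx i ψ) Ω := fun z hz => by
  simp only [dx, fderiv_congr_of_eqOn hΩ h hz]

theorem eqOn_dy (hΩ : IsOpen Ω) (h : Set.EqOn φ ψ Ω) (i : Fin n) :
    Set.EqOn (dy i φ) (dy i ψ) Ω := fun z hz => by
  simp only [dy, fderiv_congr_of_eqOn hΩ h hz]

theorem fderiv_comm_apply (hΩ : IsOpen Ω) (hφ : ContDiffOn ℝ ∞ φ Ω) (hz : z ∈ Ω)
    (v w : Coord n × Coord n) :
    fderiv ℝ (fun z => fderiv ℝ φ z v) z w = fderiv ℝ (fun z => fderiv ℝ φ z w) z v := by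
  have hd : DifferentiableAt ℝ (fderiv ℝ φ) z :=
    ((hφ.fderiv_of_isOpen (m := ∞) hΩ (by simp)).contDiffAt (hΩ.mem_nhds hz)).differentiableAt
      (by simp)
  have hs : IsSymmSndFDerivAt ℝ φ z :=
    (hφ.contDiffAt (hΩ.mem_nhds hz)).isSymmSndFDerivAt
      (by simpa using WithTop.coe_le_coe.2 (le_top : (2 : ℕ∞) ≤ ⊤))
  rw [fderiv_clm_apply hd (differentiableAt_const _),
    fderiv_clm_apply hd (differentiableAt_const _)]
  simpa using hs w v

theorem dy_dy_comm (hΩ : IsOpen Ω) (hφ : ContDiffOn ℝ ∞ φ Ω) (hz : z ∈ Ω) (i j : Fin n) :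
    dy i (dy j φ) z = dy j (dy i φ) z := fderiv_comm_apply hΩ hφ hz _ _

theorem dx_dy_comm (hΩ : IsOpen Ω) (hφ : ContDiffOn ℝ ∞ φ Ω) (hz : z ∈ Ω) (i j : Fin n) :
    dx i (dy j φ) z = dy j (dx i φ) z := fderiv_comm_apply hΩ hφ hz _ _

theorem fderiv_mul_apply (hΩ : IsOpen Ω) (hφ : ContDiffOn ℝ ∞ φ Ω) (hψ : ContDiffOn ℝ ∞ ψ Ω)
    (hz : z ∈ Ω) (v : Coord n × Coord n) :
    fderiv ℝ (fun w => φ w * ψ w) z v = fderiv ℝ φ z v * ψ z + φ z * fderiv ℝ ψ z v := by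
  rw [fderiv_fun_mul (differentiableAt_of_contDiffOn hΩ hφ hz)
    (differentiableAt_of_contDiffOn hΩ hψ hz)]
  simp [smul_eq_mul]; ring

theorem fderiv_sum_mul_apply {ι : Type*} [Fintype ι] {A B : ι → Coord n × Coord n → ℝ}
    (hΩ : IsOpen Ω) (hA : ∀ m, ContDiffOn ℝ ∞ (A m) Ω)
    (hB : ∀ m, ContDiffOn ℝ ∞ (B m) Ω) (hz : z ∈ Ω) (v : Coord n × Coord n) :
    fderiv ℝ (fun w => ∑ m, A m w * B m w) z v
      = ∑ m, fderiv ℝ (A m) z v * B m z + ∑ m, A m z * fderiv ℝ (B m) z v := by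
  rw [fderiv_fun_sum fun m _ => differentiableAt_of_contDiffOn hΩ ((hA m).mul (hB m)) hz]
  simp only [sum_apply, fderiv_mul_apply hΩ (hA _) (hB _) hz,
    Finset.sum_add_distrib]

theorem dx_mul (hΩ : IsOpen Ω) (hφ : ContDiffOn ℝ ∞ φ Ω) (hψ : ContDiffOn ℝ ∞ ψ Ω)
    (hz : z ∈ Ω) (i : Fin n) :
    dx i (fun w => φ w * ψ w) z = dx i φ z * ψ z + φ z * dx i ψ z :=
  fderiv_mul_apply hΩ hφ hψ hz _

theorem dy_mul (hΩ : IsOpen Ω) (hφ : ContDiffOn ℝ ∞ φ Ω) (hψ : ContDiffOn ℝ ∞ ψ Ω)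
    (hz : z ∈ Ω) (i : Fin n) :
    dy i (fun w => φ w * ψ w) z = dy i φ z * ψ z + φ z * dy i ψ z :=
  fderiv_mul_apply hΩ hφ hψ hz _

theorem dx_sum_mul {ι : Type*} [Fintype ι] {A B : ι → Coord n × Coord n → ℝ}
    (hΩ : IsOpen Ω) (hA : ∀ m, ContDiffOn ℝ ∞ (A m) Ω)
    (hB : ∀ m, ContDiffOn ℝ ∞ (B m) Ω) (hz : z ∈ Ω) (i : Fin n) :
    dx i (fun w => ∑ m, A m w * B m w) z
      = ∑ m, dx i (A m) z * B m z + ∑ m, A m z * dx i (B m) z :=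
  fderiv_sum_mul_apply hΩ hA hB hz _

theorem dy_sum_mul {ι : Type*} [Fintype ι] {A B : ι → Coord n × Coord n → ℝ}
    (hΩ : IsOpen Ω) (hA : ∀ m, ContDiffOn ℝ ∞ (A m) Ω)
    (hB : ∀ m, ContDiffOn ℝ ∞ (B m) Ω) (hz : z ∈ Ω) (i : Fin n) :
    dy i (fun w => ∑ m, A m w * B m w) z
      = ∑ m, dy i (A m) z * B m z + ∑ m, A m z * dy i (B m) z :=
  fderiv_sum_mul_apply hΩ hA hB hz _

theorem dx_add (hΩ : IsOpen Ω) (hφ : ContDiffOn ℝ ∞ φ Ω) (hψ : ContDiffOn ℝ ∞ ψ Ω)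
    (hz : z ∈ Ω) (i : Fin n) : dx i (fun w => φ w + ψ w) z = dx i φ z + dx i ψ z := by
  simp [dx, fderiv_fun_add (differentiableAt_of_contDiffOn hΩ hφ hz)
    (differentiableAt_of_contDiffOn hΩ hψ hz)]

theorem dy_add (hΩ : IsOpen Ω) (hφ : ContDiffOn ℝ ∞ φ Ω) (hψ : ContDiffOn ℝ ∞ ψ Ω)
    (hz : z ∈ Ω) (i : Fin n) : dy i (fun w => φ w + ψ w) z = dy i φ z + dy i ψ z := by
  simp [dy, fderiv_fun_add (differentiableAt_of_contDiffOn hΩ hφ hz)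
    (differentiableAt_of_contDiffOn hΩ hψ hz)]

theorem dy_sub (hΩ : IsOpen Ω) (hφ : ContDiffOn ℝ ∞ φ Ω) (hψ : ContDiffOn ℝ ∞ ψ Ω)
    (hz : z ∈ Ω) (i : Fin n) : dy i (fun w => φ w - ψ w) z = dy i φ z - dy i ψ z := by
  simp [dy, fderiv_fun_sub (differentiableAt_of_contDiffOn hΩ hφ hz)
    (differentiableAt_of_contDiffOn hΩ hψ hz)]

theorem dx_const_mul (hΩ : IsOpen Ω) (hφ : ContDiffOn ℝ ∞ φ Ω) (hz : z ∈ Ω) (c : ℝ)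
    (i : Fin n) : dx i (fun w => c * φ w) z = c * dx i φ z := by
  simp [dx, fderiv_const_mul (differentiableAt_of_contDiffOn hΩ hφ hz)]

theorem dy_const_mul (hΩ : IsOpen Ω) (hφ : ContDiffOn ℝ ∞ φ Ω) (hz : z ∈ Ω) (c : ℝ)
    (i : Fin n) : dy i (fun w => c * φ w) z = c * dy i φ z := by
  simp [dy, fderiv_const_mul (differentiableAt_of_contDiffOn hΩ hφ hz)]

theorem contDiffOn_snd_apply (m : Fin n) :
    ContDiffOn ℝ ∞ (fun w : Coord n × Coord n => w.2 m) Ω :=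
  ((EuclideanSpace.proj (𝕜 := ℝ) m).contDiff.comp contDiff_snd).contDiffOn

theorem fderiv_snd_apply (m : Fin n) (z v : Coord n × Coord n) :
    fderiv ℝ (fun w : Coord n × Coord n => w.2 m) z v = v.2 m := by
  have : (fun w : Coord n × Coord n => w.2 m)
      = ((EuclideanSpace.proj (𝕜 := ℝ) m).comp (ContinuousLinearMap.snd ℝ (Coord n) (Coord n))) :=
    rfl
  rw [this, ContinuousLinearMap.fderiv]; rfl

theorem dx_snd_apply (i m : Fin n) (z : Coord n × Coord n) :
    dx i (fun w : Coord n × Coord n => w.2 m) z = 0 := by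
  simp [dx, fderiv_snd_apply]

theorem dy_snd_apply (i m : Fin n) (z : Coord n × Coord n) :
    dy i (fun w : Coord n × Coord n => w.2 m) z = if m = i then 1 else 0 := by
  simp [dy, fderiv_snd_apply, eq_comm]

/-- A directional derivative is the combination of the partial derivatives. -/
theorem sum_mul_dy (φ : Coord n × Coord n → ℝ) (z : Coord n × Coord n) (v : Coord n) :
    ∑ m, v m * dy m φ z = fderiv ℝ φ z (0, v) := by
  have hv : (0, v) = ∑ m, v m • ((0, basisVec m) : Coord n × Coord n) := by
    ext i
    · simp [Prod.fst_sum]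
    · simp [Prod.snd_sum, Pi.single_apply]
  rw [hv, map_sum]; simp only [map_smul, smul_eq_mul, dy]

theorem dy_comp_fst {c : Coord n → ℝ} (hc : DifferentiableAt ℝ c z.1) (i : Fin n) :
    dy i (fun w => c w.1) z = 0 := by
  have := (hc.hasFDerivAt.comp z (hasFDerivAt_fst (𝕜 := ℝ) (E := Coord n) (F := Coord n) (p := z)))
  have h2 := this.fderiv
  simp only [Function.comp_def] at h2
  simp [dy, h2]

end Calculus

/-! ### Contractions and homogeneity -/

section Contractions

variable {n : ℕ}

theorem contDiffOn_matrix_det {ι E : Type*} [Fintype ι] [DecidableEq ι] [NormedAddCommGroup E]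
    [NormedSpace ℝ E] {A : E → Matrix ι ι ℝ} {s : Set E}
    (hA : ∀ i j, ContDiffOn ℝ ∞ (fun z => A z i j) s) :
    ContDiffOn ℝ ∞ (fun z => (A z).det) s := by
  simp only [Matrix.det_apply]
  exact ContDiffOn.sum fun σ _ => (contDiffOn_prod fun i _ => hA _ _).const_smul _

theorem contDiffOn_matrix_inv {ι E : Type*} [Fintype ι] [DecidableEq ι] [NormedAddCommGroup E]
    [NormedSpace ℝ E] {A : E → Matrix ι ι ℝ} {s : Set E}
    (hA : ∀ i j, ContDiffOn ℝ ∞ (fun z => A z i j) s) (hdet : ∀ z ∈ s, (A z).det ≠ 0) (i j : ι) :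
    ContDiffOn ℝ ∞ (fun z => (A z)⁻¹ i j) s := by
  simp only [Matrix.inv_def, Ring.inverse_eq_inv', Matrix.smul_apply, smul_eq_mul,
    Matrix.adjugate_apply]
  refine ((contDiffOn_matrix_det hA).inv hdet).mul (contDiffOn_matrix_det fun k l => ?_)
  simp only [Matrix.updateRow_apply]
  split_ifs
  · exact contDiffOn_const
  · exact hA k l

/-- The slit tangent bundle over the part `U` of `ℝⁿ`, in natural coordinates. -/
def slitOver (U : Set (Coord n)) : Set (Coord n × Coord n) := {z | z.1 ∈ U ∧ z.2 ≠ 0}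

theorem isOpen_slitOver {U : Set (Coord n)} (hU : IsOpen U) : IsOpen (slitOver U) :=
  (hU.preimage continuous_fst).inter (isOpen_ne.preimage continuous_snd)

/-- The vertical derivative `Aᵐ ∂φ/∂yᵐ`. -/
def vert (A : Fin n → Coord n × Coord n → ℝ) (φ : Coord n × Coord n → ℝ)
    (z : Coord n × Coord n) : ℝ := ∑ m, A m z * dy m φ z

/-- The derivative `yˢ ∂φ/∂xˢ`. -/
def alongDx (φ : Coord n × Coord n → ℝ) (z : Coord n × Coord n) : ℝ := ∑ s, z.2 s * dx s φ z

/-- The Euler operator `yᵐ ∂φ/∂yᵐ`. -/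
def euler (φ : Coord n × Coord n → ℝ) (z : Coord n × Coord n) : ℝ := ∑ m, z.2 m * dy m φ z

variable {Ω : Set (Coord n × Coord n)} {φ ψ : Coord n × Coord n → ℝ}
  {A : Fin n → Coord n × Coord n → ℝ} {z : Coord n × Coord n}

theorem contDiffOn_vert (hΩ : IsOpen Ω) (hA : ∀ m, ContDiffOn ℝ ∞ (A m) Ω)
    (hφ : ContDiffOn ℝ ∞ φ Ω) : ContDiffOn ℝ ∞ (vert A φ) Ω :=
  ContDiffOn.sum fun m _ => (hA m).mul (contDiffOn_dy hΩ hφ m)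

theorem contDiffOn_alongDx (hΩ : IsOpen Ω) (hφ : ContDiffOn ℝ ∞ φ Ω) :
    ContDiffOn ℝ ∞ (alongDx φ) Ω :=
  ContDiffOn.sum fun m _ => (contDiffOn_snd_apply m).mul (contDiffOn_dx hΩ hφ m)

theorem dy_vert (hΩ : IsOpen Ω) (hA : ∀ m, ContDiffOn ℝ ∞ (A m) Ω)
    (hφ : ContDiffOn ℝ ∞ φ Ω) (hz : z ∈ Ω) (j : Fin n) :
    dy j (vert A φ) z = vert (fun m => dy j (A m)) φ z + vert A (dy j φ) z := by
  unfold vert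
  rw [dy_sum_mul hΩ hA (fun m => contDiffOn_dy hΩ hφ m) hz]
  simp only [dy_dy_comm hΩ hφ hz j]

theorem dy_alongDx (hΩ : IsOpen Ω) (hφ : ContDiffOn ℝ ∞ φ Ω) (hz : z ∈ Ω) (j : Fin n) :
    dy j (alongDx φ) z = dx j φ z + alongDx (dy j φ) z := by
  unfold alongDx
  rw [dy_sum_mul hΩ contDiffOn_snd_apply (fun m => contDiffOn_dx hΩ hφ m) hz]
  simp [dy_snd_apply, dx_dy_comm hΩ hφ hz]

theorem dy_euler (hΩ : IsOpen Ω) (hφ : ContDiffOn ℝ ∞ φ Ω) (hz : z ∈ Ω) (j : Fin n) :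
    dy j (euler φ) z = dy j φ z + euler (dy j φ) z := by
  unfold euler
  rw [dy_sum_mul hΩ contDiffOn_snd_apply (fun m => contDiffOn_dy hΩ hφ m) hz]
  simp [dy_snd_apply, dy_dy_comm hΩ hφ hz j]

theorem dx_euler (hΩ : IsOpen Ω) (hφ : ContDiffOn ℝ ∞ φ Ω) (hz : z ∈ Ω) (j : Fin n) :
    dx j (euler φ) z = euler (dx j φ) z := by
  unfold euler
  rw [dx_sum_mul hΩ contDiffOn_snd_apply (fun m => contDiffOn_dy hΩ hφ m) hz]
  simp [dx_snd_apply, dx_dy_comm hΩ hφ hz j]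

theorem euler_mul (hΩ : IsOpen Ω) (hφ : ContDiffOn ℝ ∞ φ Ω) (hψ : ContDiffOn ℝ ∞ ψ Ω)
    (hz : z ∈ Ω) : euler (fun w => φ w * ψ w) z = euler φ z * ψ z + φ z * euler ψ z := by
  simp only [euler, dy_mul hΩ hφ hψ hz, Finset.sum_mul, Finset.mul_sum,
    ← Finset.sum_add_distrib]
  exact Finset.sum_congr rfl fun _ _ => by ring

/-- `φ` is homogeneous of degree `d` along the fibres, in the form of Euler's equation. -/
def IsEulerHom (Ω : Set (Coord n × Coord n)) (d : ℝ) (φ : Coord n × Coord n → ℝ) : Prop :=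
  ∀ z ∈ Ω, euler φ z = d * φ z

theorem IsEulerHom.dy {d : ℝ} (hΩ : IsOpen Ω) (hφ : ContDiffOn ℝ ∞ φ Ω)
    (h : IsEulerHom Ω d φ) (j : Fin n) : IsEulerHom Ω (d - 1) (dy j φ) := fun z hz => by
  have h1 := eqOn_dy hΩ (fun z hz => h z hz) j hz
  rw [dy_euler hΩ hφ hz, dy_const_mul hΩ hφ hz] at h1
  linarith

theorem IsEulerHom.dx {d : ℝ} (hΩ : IsOpen Ω) (hφ : ContDiffOn ℝ ∞ φ Ω)
    (h : IsEulerHom Ω d φ) (j : Fin n) : IsEulerHom Ω d (dx j φ) := fun z hz => by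
  have h1 := eqOn_dx hΩ (fun z hz => h z hz) j hz
  rwa [dx_euler hΩ hφ hz, dx_const_mul hΩ hφ hz] at h1

theorem IsEulerHom.mul {d d' : ℝ} (hΩ : IsOpen Ω) (hφ : ContDiffOn ℝ ∞ φ Ω)
    (hψ : ContDiffOn ℝ ∞ ψ Ω) (h : IsEulerHom Ω d φ) (h' : IsEulerHom Ω d' ψ) :
    IsEulerHom Ω (d + d') (fun w => φ w * ψ w) := fun z hz => by
  rw [euler_mul hΩ hφ hψ hz, h z hz, h' z hz]; ring

theorem IsEulerHom.alongDx {d : ℝ} (hΩ : IsOpen Ω) (hφ : ContDiffOn ℝ ∞ φ Ω)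
    (h : IsEulerHom Ω d φ) : IsEulerHom Ω (d + 1) (alongDx φ) := fun z hz => by
  have h1 : euler (FinslerGeom.alongDx φ) z
      = ∑ j, z.2 j * FinslerGeom.dx j φ z
        + ∑ j, z.2 j * FinslerGeom.alongDx (FinslerGeom.dy j φ) z := by
    unfold euler
    simp only [dy_alongDx hΩ hφ hz, mul_add, Finset.sum_add_distrib]
  have h2 : ∑ j, z.2 j * FinslerGeom.alongDx (FinslerGeom.dy j φ) z
      = ∑ s, z.2 s * euler (FinslerGeom.dx s φ) z := by
    simp only [FinslerGeom.alongDx, euler, Finset.mul_sum]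
    rw [Finset.sum_comm]
    refine Finset.sum_congr rfl fun s _ => Finset.sum_congr rfl fun j _ => ?_
    rw [dx_dy_comm hΩ hφ hz]; ring
  rw [h1, h2]
  simp only [h.dx hΩ hφ _ z hz, mul_left_comm _ d, ← Finset.mul_sum]
  simp only [FinslerGeom.alongDx]; ring

theorem IsEulerHom.const_mul {d : ℝ} (hΩ : IsOpen Ω) (hφ : ContDiffOn ℝ ∞ φ Ω)
    (h : IsEulerHom Ω d φ) (c : ℝ) : IsEulerHom Ω d (fun w => c * φ w) := fun z hz => by
  have h1 := h z hz
  simp only [euler, dy_const_mul hΩ hφ hz, mul_left_comm _ c, ← Finset.mul_sum] at h1 ⊢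
  rw [h1]

theorem IsEulerHom.sub {d : ℝ} (hΩ : IsOpen Ω) (hφ : ContDiffOn ℝ ∞ φ Ω)
    (hψ : ContDiffOn ℝ ∞ ψ Ω) (h : IsEulerHom Ω d φ) (h' : IsEulerHom Ω d ψ) :
    IsEulerHom Ω d (fun w => φ w - ψ w) := fun z hz => by
  have h1 := h z hz
  have h2 := h' z hz
  simp only [euler, dy_sub hΩ hφ hψ hz, mul_sub, Finset.sum_sub_distrib] at h1 h2 ⊢
  rw [h1, h2]

theorem IsEulerHom.sum_mul {ι : Type*} [Fintype ι] {B C : ι → Coord n × Coord n → ℝ} {d e : ℝ}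
    (hΩ : IsOpen Ω) (hB : ∀ m, ContDiffOn ℝ ∞ (B m) Ω) (hC : ∀ m, ContDiffOn ℝ ∞ (C m) Ω)
    (h : ∀ m, IsEulerHom Ω d (B m)) (h' : ∀ m, IsEulerHom Ω e (C m)) :
    IsEulerHom Ω (d + e) (fun w => ∑ m, B m w * C m w) := fun z hz => by
  have h1 : euler (fun w => ∑ m, B m w * C m w) z
      = ∑ m, (euler (B m) z * C m z + B m z * euler (C m) z) := by
    simp only [euler, dy_sum_mul hΩ hB hC hz, mul_add, Finset.sum_add_distrib, Finset.mul_sum,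
      Finset.sum_mul]
    congr 1 <;> rw [Finset.sum_comm] <;>
      exact Finset.sum_congr rfl fun _ _ => Finset.sum_congr rfl fun _ _ => by ring
  rw [h1, Finset.mul_sum]
  exact Finset.sum_congr rfl fun m _ => by rw [h m z hz, h' m z hz]; ring

/-- Positive homogeneity of degree one implies Euler's equation. -/
theorem isEulerHom_one {U : Set (Coord n)} (hU : IsOpen U)
    (hφ : ContDiffOn ℝ ∞ φ (slitOver U))
    (h : ∀ z ∈ slitOver U, ∀ c : ℝ, 0 < c → φ (z.1, c • z.2) = c * φ z) :
    IsEulerHom (slitOver U) 1 φ := fun z hz => by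
  have hd := (differentiableAt_of_contDiffOn (isOpen_slitOver hU) hφ hz).hasFDerivAt
  have hl : HasDerivAt (fun c : ℝ => (z.1, c • z.2)) (0, z.2) 1 := by
    simpa using (hasDerivAt_const (1 : ℝ) z.1).prodMk ((hasDerivAt_id (1 : ℝ)).smul_const z.2)
  have h1 : HasDerivAt (fun c : ℝ => φ (z.1, c • z.2)) (fderiv ℝ φ z (0, z.2)) 1 := by
    have := HasFDerivAt.comp_hasDerivAt (1 : ℝ) (by simpa using hd) hl
    simpa [Function.comp_def] using this
  have h2 : HasDerivAt (fun c : ℝ => φ (z.1, c • z.2)) (φ z) 1 := by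
    have h3 : HasDerivAt (fun c : ℝ => c * φ z) (φ z) 1 := by
      simpa using (hasDerivAt_id (1 : ℝ)).mul_const (φ z)
    refine h3.congr_of_eventuallyEq ?_
    filter_upwards [lt_mem_nhds (zero_lt_one' ℝ)] with c hc using h z hz c hc
  rw [euler, sum_mul_dy, h1.unique h2, one_mul]

end Contractions

/-! ### The Landsberg curvature in terms of the spray -/

section LocalFinsler

variable {n : ℕ}

/-- `f` is the coordinate expression over `U ⊆ ℝⁿ` of a Finsler metric. -/
structure IsLocalFinsler (U : Set (Coord n)) (f : Coord n × Coord n → ℝ) : Prop where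
  isOpen : IsOpen U
  smooth : ContDiffOn ℝ ∞ f (slitOver U)
  hom : IsEulerHom (slitOver U) 1 f
  posDef : ∀ z ∈ slitOver U, (fundMatrix f z).PosDef

namespace IsLocalFinsler

variable {U : Set (Coord n)} {f : Coord n × Coord n → ℝ} {z : Coord n × Coord n}

theorem isOpen_slit (hf : IsLocalFinsler U f) : IsOpen (slitOver U) := isOpen_slitOver hf.isOpen

theorem energy_smooth (hf : IsLocalFinsler U f) : ContDiffOn ℝ ∞ (energy f) (slitOver U) :=
  hf.smooth.pow 2

theorem energy_hom (hf : IsLocalFinsler U f) : IsEulerHom (slitOver U) 2 (energy f) := by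
  have h := hf.hom.mul hf.isOpen_slit hf.smooth hf.smooth hf.hom
  have he : energy f = fun w => f w * f w := by ext w; simp [energy, sq]
  rw [he]; convert h using 1; norm_num

theorem dy_smooth (hf : IsLocalFinsler U f) (i : Fin n) :
    ContDiffOn ℝ ∞ (dy i (energy f)) (slitOver U) :=
  contDiffOn_dy hf.isOpen_slit hf.energy_smooth i

theorem dy_dy_smooth (hf : IsLocalFinsler U f) (i j : Fin n) :
    ContDiffOn ℝ ∞ (dy j (dy i (energy f))) (slitOver U) :=
  contDiffOn_dy hf.isOpen_slit (hf.dy_smooth i) j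

theorem dy_hom (hf : IsLocalFinsler U f) (i : Fin n) :
    IsEulerHom (slitOver U) 1 (dy i (energy f)) := by
  convert hf.energy_hom.dy hf.isOpen_slit hf.energy_smooth i using 1; norm_num

theorem dy_dy_hom (hf : IsLocalFinsler U f) (i j : Fin n) :
    IsEulerHom (slitOver U) 0 (dy j (dy i (energy f))) := by
  convert (hf.dy_hom i).dy hf.isOpen_slit (hf.dy_smooth i) j using 1; norm_num

theorem fundTensor_smooth (hf : IsLocalFinsler U f) (i j : Fin n) :
    ContDiffOn ℝ ∞ (fundTensor f i j) (slitOver U) :=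
  contDiffOn_const.mul (hf.dy_dy_smooth j i)

theorem fundTensor_symm (hf : IsLocalFinsler U f) (hz : z ∈ slitOver U) (i j : Fin n) :
    fundTensor f i j z = fundTensor f j i z := by
  simp only [fundTensor, dy_dy_comm hf.isOpen_slit hf.energy_smooth hz i j]

theorem det_ne_zero (hf : IsLocalFinsler U f) (hz : z ∈ slitOver U) : (fundMatrix f z).det ≠ 0 :=
  (hf.posDef z hz).det_pos.ne'

theorem isUnit_det (hf : IsLocalFinsler U f) (hz : z ∈ slitOver U) :
    IsUnit (fundMatrix f z).det := (hf.det_ne_zero hz).isUnit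

theorem fundInv_smooth (hf : IsLocalFinsler U f) (i j : Fin n) :
    ContDiffOn ℝ ∞ (fundInv f i j) (slitOver U) :=
  contDiffOn_matrix_inv (A := fundMatrix f) (fun i j => hf.fundTensor_smooth i j)
    (fun _ hz => hf.det_ne_zero hz) i j

/-- Raising the index of `g_lm vᵐ` gives back `v`. -/
theorem sum_fundInv_mul (hf : IsLocalFinsler U f) (hz : z ∈ slitOver U) (v : Fin n → ℝ)
    (i : Fin n) : ∑ l, fundInv f i l z * ∑ m, fundTensor f l m z * v m = v i := by
  have h : ((fundMatrix f z)⁻¹.mulVec ((fundMatrix f z).mulVec v)) i = v i := by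
    rw [Matrix.mulVec_mulVec, Matrix.nonsing_inv_mul _ (hf.isUnit_det hz), Matrix.one_mulVec]
  exact h

/-- Lowering the index of `gⁱˡ w_l` gives back `w`. -/
theorem sum_fundTensor_mul (hf : IsLocalFinsler U f) (hz : z ∈ slitOver U) (w : Fin n → ℝ)
    (i : Fin n) : ∑ l, fundTensor f i l z * ∑ m, fundInv f l m z * w m = w i := by
  have h : ((fundMatrix f z).mulVec ((fundMatrix f z)⁻¹.mulVec w)) i = w i := by
    rw [Matrix.mulVec_mulVec, Matrix.mul_nonsing_inv _ (hf.isUnit_det hz), Matrix.one_mulVec]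
  exact h

theorem vert_dy (hf : IsLocalFinsler U f) (hz : z ∈ slitOver U)
    (A : Fin n → Coord n × Coord n → ℝ) (l : Fin n) :
    vert A (dy l (energy f)) z = 2 * ∑ m, fundTensor f l m z * A m z := by
  simp only [vert, Finset.mul_sum]
  refine Finset.sum_congr rfl fun m _ => ?_
  rw [hf.fundTensor_symm hz, fundTensor]; ring

/-- The components `A` of a vertical vector are determined by `Aᵐ ∂²F²/∂yᵐ∂yˡ`. -/
theorem eq_of_vert_dy_eq (hf : IsLocalFinsler U f) (hz : z ∈ slitOver U)
    {A B : Fin n → Coord n × Coord n → ℝ}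
    (h : ∀ l, vert A (dy l (energy f)) z = vert B (dy l (energy f)) z) (i : Fin n) :
    A i z = B i z := by
  rw [← hf.sum_fundInv_mul hz (fun m => A m z), ← hf.sum_fundInv_mul hz (fun m => B m z)]
  refine Finset.sum_congr rfl fun l _ => ?_
  have := h l
  rw [hf.vert_dy hz, hf.vert_dy hz] at this
  rw [mul_left_cancel₀ two_ne_zero this]

theorem sprayCoeff_eq (f : Coord n × Coord n → ℝ) (z : Coord n × Coord n) (i : Fin n) :
    sprayCoeff f i z
      = ∑ l, fundInv f i l z * ((1 / 4) * (alongDx (dy l (energy f)) z - dx l (energy f) z)) := by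
  simp only [sprayCoeff, alongDx, Finset.mul_sum]
  refine Finset.sum_congr rfl fun l _ => ?_
  simp only [mul_comm (z.2 _)]; ring

theorem spray_smooth (hf : IsLocalFinsler U f) (i : Fin n) :
    ContDiffOn ℝ ∞ (sprayCoeff f i) (slitOver U) := by
  have h : sprayCoeff f i = fun z => ∑ l, fundInv f i l z *
      ((1 / 4) * (alongDx (dy l (energy f)) z - dx l (energy f) z)) := by
    ext z; exact sprayCoeff_eq f z i
  rw [h]
  exact ContDiffOn.sum fun l _ => (hf.fundInv_smooth i l).mul (contDiffOn_const.mul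
    ((contDiffOn_alongDx hf.isOpen_slit (hf.dy_smooth l)).sub
      (contDiffOn_dx hf.isOpen_slit hf.energy_smooth l)))

theorem nonlin_smooth (hf : IsLocalFinsler U f) (m k : Fin n) :
    ContDiffOn ℝ ∞ (nonlinCoeff f m k) (slitOver U) :=
  contDiffOn_dy hf.isOpen_slit (hf.spray_smooth m) k

/-- The equation of the geodesic spray. -/
theorem alongDx_dy (hf : IsLocalFinsler U f) (hz : z ∈ slitOver U) (l : Fin n) :
    alongDx (dy l (energy f)) z - dx l (energy f) z
      = 2 * vert (sprayCoeff f) (dy l (energy f)) z := by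
  rw [hf.vert_dy hz]
  simp only [sprayCoeff_eq]
  rw [hf.sum_fundTensor_mul hz]; ring

/-- The equation of the geodesic spray characterizes the spray coefficients. -/
theorem spray_unique (hf : IsLocalFinsler U f) (hz : z ∈ slitOver U)
    {A : Fin n → Coord n × Coord n → ℝ}
    (h : ∀ l, alongDx (dy l (energy f)) z - dx l (energy f) z
      = 2 * vert A (dy l (energy f)) z) (i : Fin n) : sprayCoeff f i z = A i z :=
  hf.eq_of_vert_dy_eq hz (fun l => by linarith [h l, hf.alongDx_dy hz l]) i

theorem sum_mul_vert_dy (hf : IsLocalFinsler U f) (hz : z ∈ slitOver U)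
    (A : Fin n → Coord n × Coord n → ℝ) :
    ∑ l, z.2 l * vert A (dy l (energy f)) z = vert A (energy f) z := by
  simp only [vert, Finset.mul_sum]
  rw [Finset.sum_comm]
  refine Finset.sum_congr rfl fun m _ => ?_
  have := hf.dy_hom m z hz
  simp only [euler] at this
  simp only [dy_dy_comm hf.isOpen_slit hf.energy_smooth hz m, mul_left_comm _ (A m z),
    ← Finset.mul_sum, this]
  ring

/-- `F²` is constant along the geodesic spray. -/
theorem alongDx_energy (hf : IsLocalFinsler U f) (hz : z ∈ slitOver U) :
    alongDx (energy f) z = 2 * vert (sprayCoeff f) (energy f) z := by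
  have hΩ := hf.isOpen_slit
  have h1 : ∑ l, z.2 l * alongDx (dy l (energy f)) z = 2 * alongDx (energy f) z := by
    simp only [alongDx, Finset.mul_sum]
    rw [Finset.sum_comm]
    refine Finset.sum_congr rfl fun s _ => ?_
    have := hf.energy_hom.dx hΩ hf.energy_smooth s z hz
    simp only [euler] at this
    simp only [dx_dy_comm hΩ hf.energy_smooth hz, mul_left_comm _ (z.2 s), ← Finset.mul_sum, this]
  have h2 := hf.sum_mul_vert_dy hz (sprayCoeff f)
  have h3 : ∑ l, z.2 l * (alongDx (dy l (energy f)) z - dx l (energy f) z)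
      = ∑ l, z.2 l * (2 * vert (sprayCoeff f) (dy l (energy f)) z) :=
    Finset.sum_congr rfl fun l _ => by rw [hf.alongDx_dy hz]
  simp only [mul_sub, Finset.sum_sub_distrib, mul_left_comm _ (2 : ℝ), ← Finset.mul_sum] at h3
  rw [h1, h2] at h3
  have h4 : ∑ l, z.2 l * dx l (energy f) z = alongDx (energy f) z := rfl
  linarith

/-- `F²` is constant along the horizontal distribution. -/
theorem dx_energy (hf : IsLocalFinsler U f) (hz : z ∈ slitOver U) (i : Fin n) :
    dx i (energy f) z = vert (fun m => nonlinCoeff f m i) (energy f) z := by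
  have hΩ := hf.isOpen_slit
  have h := eqOn_dy hΩ (fun z hz => hf.alongDx_energy hz) i hz
  rw [dy_alongDx hΩ hf.energy_smooth hz,
    dy_const_mul hΩ (contDiffOn_vert hΩ hf.spray_smooth hf.energy_smooth) hz,
    dy_vert hΩ hf.spray_smooth hf.energy_smooth hz] at h
  have h2 := hf.alongDx_dy hz i
  change _ = 2 * (vert (fun m => nonlinCoeff f m i) (energy f) z + _) at h
  linarith

theorem dx_dy_energy (hf : IsLocalFinsler U f) (hz : z ∈ slitOver U) (i j : Fin n) :
    dx i (dy j (energy f)) z = vert (fun m => dy j (nonlinCoeff f m i)) (energy f) z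
      + vert (fun m => nonlinCoeff f m i) (dy j (energy f)) z := by
  have hΩ := hf.isOpen_slit
  have h := eqOn_dy hΩ (fun z hz => hf.dx_energy hz i) j hz
  rwa [← dx_dy_comm hΩ hf.energy_smooth hz,
    dy_vert hΩ (fun m => hf.nonlin_smooth m i) hf.energy_smooth hz] at h

theorem dx_dy_dy_energy (hf : IsLocalFinsler U f) (hz : z ∈ slitOver U) (i j k : Fin n) :
    dx i (dy k (dy j (energy f))) z
      = vert (fun m => dy k (dy j (nonlinCoeff f m i))) (energy f) z
      + vert (fun m => dy j (nonlinCoeff f m i)) (dy k (energy f)) z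
      + vert (fun m => dy k (nonlinCoeff f m i)) (dy j (energy f)) z
      + vert (fun m => nonlinCoeff f m i) (dy k (dy j (energy f))) z := by
  have hΩ := hf.isOpen_slit
  have hN := fun m => hf.nonlin_smooth m i
  have hN' := fun m => contDiffOn_dy hΩ (hN m) j
  have h := eqOn_dy hΩ (fun z hz => hf.dx_dy_energy hz i j) k hz
  rw [← dx_dy_comm hΩ (hf.dy_smooth j) hz,
    dy_add hΩ (contDiffOn_vert hΩ hN' hf.energy_smooth) (contDiffOn_vert hΩ hN (hf.dy_smooth j)) hz,
    dy_vert hΩ hN' hf.energy_smooth hz, dy_vert hΩ hN (hf.dy_smooth j) hz] at h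
  rw [h]; ring

theorem alongDx_dy_dy (hf : IsLocalFinsler U f) (hz : z ∈ slitOver U) (i j : Fin n) :
    dx j (dy i (energy f)) z + alongDx (dy j (dy i (energy f))) z - dx i (dy j (energy f)) z
      = 2 * (vert (fun m => nonlinCoeff f m j) (dy i (energy f)) z
        + vert (sprayCoeff f) (dy j (dy i (energy f))) z) := by
  have hΩ := hf.isOpen_slit
  have h := eqOn_dy hΩ (fun z hz => hf.alongDx_dy hz i) j hz
  rw [dy_sub hΩ (contDiffOn_alongDx hΩ (hf.dy_smooth i)) (contDiffOn_dx hΩ hf.energy_smooth i) hz,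
    dy_alongDx hΩ (hf.dy_smooth i) hz, ← dx_dy_comm hΩ hf.energy_smooth hz,
    dy_const_mul hΩ (contDiffOn_vert hΩ hf.spray_smooth (hf.dy_smooth i)) hz,
    dy_vert hΩ hf.spray_smooth (hf.dy_smooth i) hz] at h
  exact h

theorem alongDx_dy_dy_dy (hf : IsLocalFinsler U f) (hz : z ∈ slitOver U) (i j k : Fin n) :
    dx j (dy k (dy i (energy f))) z + dx k (dy j (dy i (energy f))) z
        + alongDx (dy k (dy j (dy i (energy f)))) z - dx i (dy k (dy j (energy f))) z
      = 2 * (vert (fun m => dy k (nonlinCoeff f m j)) (dy i (energy f)) z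
        + vert (fun m => nonlinCoeff f m j) (dy k (dy i (energy f))) z
        + vert (fun m => nonlinCoeff f m k) (dy j (dy i (energy f))) z
        + vert (sprayCoeff f) (dy k (dy j (dy i (energy f)))) z) := by
  have hΩ := hf.isOpen_slit
  have hi := hf.dy_smooth i
  have hij := hf.dy_dy_smooth i j
  have hN := fun m => hf.nonlin_smooth m j
  have h := eqOn_dy hΩ (fun z hz => hf.alongDx_dy_dy hz i j) k hz
  rw [dy_sub hΩ ((contDiffOn_dx hΩ hi j).add (contDiffOn_alongDx hΩ hij))
      (contDiffOn_dx hΩ (hf.dy_smooth j) i) hz,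
    dy_add hΩ (contDiffOn_dx hΩ hi j) (contDiffOn_alongDx hΩ hij) hz,
    dy_alongDx hΩ hij hz, ← dx_dy_comm hΩ hi hz, ← dx_dy_comm hΩ (hf.dy_smooth j) hz,
    dy_const_mul hΩ ((contDiffOn_vert hΩ hN hi).add (contDiffOn_vert hΩ hf.spray_smooth hij)) hz,
    dy_add hΩ (contDiffOn_vert hΩ hN hi) (contDiffOn_vert hΩ hf.spray_smooth hij) hz,
    dy_vert hΩ hN hi hz, dy_vert hΩ hf.spray_smooth hij hz] at h
  change _ = 2 * (_ + _ + (vert (fun m => nonlinCoeff f m k) (dy j (dy i (energy f))) z + _)) at h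
  linarith

/-- The spray coefficients are homogeneous of degree two. -/
theorem spray_hom (hf : IsLocalFinsler U f) (m : Fin n) :
    IsEulerHom (slitOver U) 2 (sprayCoeff f m) := fun z hz => by
  have hΩ := hf.isOpen_slit
  refine hf.eq_of_vert_dy_eq hz (A := fun m => euler (sprayCoeff f m))
    (B := fun m z => 2 * sprayCoeff f m z) (fun l => ?_) m
  -- Both sides of the spray equation are homogeneous of degree two.
  have hW : IsEulerHom (slitOver U) 2
      (fun w => alongDx (dy l (energy f)) w - dx l (energy f) w) := fun z hz => by
    have h1 := (hf.dy_hom l).alongDx hΩ (hf.dy_smooth l) z hz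
    have h2 := hf.energy_hom.dx hΩ hf.energy_smooth l z hz
    simp only [euler, dy_sub hΩ (contDiffOn_alongDx hΩ (hf.dy_smooth l))
      (contDiffOn_dx hΩ hf.energy_smooth l) hz, mul_sub, Finset.sum_sub_distrib] at h1 h2 ⊢
    rw [h1, h2]; ring
  have h1 := hW z hz
  have h2 : euler (fun w => alongDx (dy l (energy f)) w - dx l (energy f) w) z
      = ∑ j, z.2 j * (2 * (vert (fun m => dy j (sprayCoeff f m)) (dy l (energy f)) z
        + vert (sprayCoeff f) (dy j (dy l (energy f))) z)) := by
    refine Finset.sum_congr rfl fun j _ => ?_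
    rw [eqOn_dy hΩ (fun z hz => hf.alongDx_dy hz l) j hz,
      dy_const_mul hΩ (contDiffOn_vert hΩ hf.spray_smooth (hf.dy_smooth l)) hz,
      dy_vert hΩ hf.spray_smooth (hf.dy_smooth l) hz]
  have h3 : ∑ j, z.2 j * vert (fun m => dy j (sprayCoeff f m)) (dy l (energy f)) z
      = vert (fun m => euler (sprayCoeff f m)) (dy l (energy f)) z := by
    simp only [vert, euler, Finset.mul_sum, Finset.sum_mul]
    rw [Finset.sum_comm]
    simp only [mul_assoc]
  have h4 : ∑ j, z.2 j * vert (sprayCoeff f) (dy j (dy l (energy f))) z = 0 := by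
    simp only [vert, Finset.mul_sum]
    rw [Finset.sum_comm]
    refine Finset.sum_eq_zero fun m _ => ?_
    have := hf.dy_dy_hom l m z hz
    simp only [euler, zero_mul] at this
    simp only [dy_dy_comm hΩ (hf.dy_smooth l) hz m, mul_left_comm _ (sprayCoeff f m z),
      ← Finset.mul_sum, this, mul_zero]
  have h5 : vert (fun m z => 2 * sprayCoeff f m z) (dy l (energy f)) z
      = 2 * vert (sprayCoeff f) (dy l (energy f)) z := by
    simp only [vert, Finset.mul_sum, mul_assoc]
  simp only [mul_add, Finset.sum_add_distrib, mul_left_comm _ (2 : ℝ), ← Finset.mul_sum,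
    h3, h4] at h2
  rw [h5]
  linarith [hf.alongDx_dy hz l]

theorem sum_mul_nonlin (hf : IsLocalFinsler U f) (hz : z ∈ slitOver U) (m : Fin n) :
    ∑ s, z.2 s * nonlinCoeff f m s z = 2 * sprayCoeff f m z := hf.spray_hom m z hz

theorem hDeriv_eq (f φ : Coord n × Coord n → ℝ) (k : Fin n) (z : Coord n × Coord n) :
    hDeriv f k φ z = dx k φ z - vert (fun m => nonlinCoeff f m k) φ z := rfl

theorem sum_mul_hDeriv (hf : IsLocalFinsler U f) (hz : z ∈ slitOver U)
    (φ : Coord n × Coord n → ℝ) :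
    ∑ s, z.2 s * hDeriv f s φ z = alongDx φ z - 2 * vert (sprayCoeff f) φ z := by
  simp only [hDeriv_eq, mul_sub, Finset.sum_sub_distrib, alongDx, vert, Finset.mul_sum]
  congr 1
  rw [Finset.sum_comm]
  refine Finset.sum_congr rfl fun m _ => ?_
  rw [← mul_assoc 2, ← hf.sum_mul_nonlin hz, Finset.sum_mul]
  simp only [mul_assoc]

theorem hDeriv_const_mul (hf : IsLocalFinsler U f) (hz : z ∈ slitOver U)
    {φ : Coord n × Coord n → ℝ} (hφ : ContDiffOn ℝ ∞ φ (slitOver U)) (c : ℝ) (k : Fin n) :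
    hDeriv f k (fun w => c * φ w) z = c * hDeriv f k φ z := by
  simp only [hDeriv, dx_const_mul hf.isOpen_slit hφ hz, dy_const_mul hf.isOpen_slit hφ hz,
    mul_sub, Finset.mul_sum, mul_left_comm _ c]

/-- `yᵏ δg_lk/δxʲ = ½ ∂²F²/∂xʲ∂yˡ`. -/
theorem sum_mul_hDeriv_fundTensor (hf : IsLocalFinsler U f) (hz : z ∈ slitOver U) (j l : Fin n) :
    ∑ k, z.2 k * hDeriv f j (fundTensor f l k) z = (1 / 2) * dx j (dy l (energy f)) z := by
  have hΩ := hf.isOpen_slit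
  have h0 : ∀ k, hDeriv f j (fundTensor f l k) z =
      (1 / 2) * hDeriv f j (dy l (dy k (energy f))) z :=
    fun k => hf.hDeriv_const_mul hz (hf.dy_dy_smooth k l) _ _
  have hc : ∀ k, Set.EqOn (dy l (dy k (energy f))) (dy k (dy l (energy f))) (slitOver U) :=
    fun k z hz => dy_dy_comm hΩ hf.energy_smooth hz l k
  have h1 : ∀ k, hDeriv f j (dy l (dy k (energy f))) z = dy k (dx j (dy l (energy f))) z
      - ∑ m, nonlinCoeff f m j z * dy k (dy m (dy l (energy f))) z := fun k => by
    rw [hDeriv, eqOn_dx hΩ (hc k) j hz, dx_dy_comm hΩ (hf.dy_smooth l) hz]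
    congr 1
    refine Finset.sum_congr rfl fun m _ => ?_
    rw [eqOn_dy hΩ (hc k) m hz, dy_dy_comm hΩ (hf.dy_smooth l) hz]
  have h2 : ∑ k, z.2 k * dy k (dx j (dy l (energy f))) z = dx j (dy l (energy f)) z := by
    simpa [euler] using (hf.dy_hom l).dx hΩ (hf.dy_smooth l) j z hz
  have h3 : ∑ k, z.2 k * ∑ m, nonlinCoeff f m j z * dy k (dy m (dy l (energy f))) z = 0 := by
    simp only [Finset.mul_sum]
    rw [Finset.sum_comm]
    refine Finset.sum_eq_zero fun m _ => ?_
    have := hf.dy_dy_hom l m z hz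
    simp only [euler, zero_mul] at this
    simp only [mul_left_comm _ (nonlinCoeff f m j z), ← Finset.mul_sum, this, mul_zero]
  simp only [h0, h1, mul_left_comm _ (1 / 2 : ℝ), ← Finset.mul_sum, mul_sub,
    Finset.sum_sub_distrib, h2, h3]
  ring

/-- The deflection of the Cartan connection vanishes: `Γⁱ_jk yᵏ = Nⁱ_j`. -/
theorem sum_mul_cartanGamma (hf : IsLocalFinsler U f) (hz : z ∈ slitOver U) (i j : Fin n) :
    ∑ k, z.2 k * cartanGamma f i j k z = nonlinCoeff f i j z := by
  have hΩ := hf.isOpen_slit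
  have h1 : ∑ k, z.2 k * cartanGamma f i j k z = ∑ l, fundInv f i l z * ((1 / 2) *
      (∑ k, z.2 k * hDeriv f j (fundTensor f l k) z + ∑ k, z.2 k * hDeriv f k (fundTensor f j l) z
        - ∑ k, z.2 k * hDeriv f l (fundTensor f j k) z)) := by
    simp only [cartanGamma, Finset.mul_sum, ← Finset.sum_add_distrib, ← Finset.sum_sub_distrib]
    rw [Finset.sum_comm]
    exact Finset.sum_congr rfl fun l _ => Finset.sum_congr rfl fun k _ => by ring
  rw [h1, ← hf.sum_fundInv_mul hz (fun m => nonlinCoeff f m j z)]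
  refine Finset.sum_congr rfl fun l _ => ?_
  congr 1
  have h2 : ∑ k, z.2 k * hDeriv f k (fundTensor f j l) z
      = (1 / 2) * (alongDx (dy j (dy l (energy f))) z
        - 2 * vert (sprayCoeff f) (dy j (dy l (energy f))) z) := by
    rw [← hf.sum_mul_hDeriv hz, Finset.mul_sum]
    refine Finset.sum_congr rfl fun k _ => ?_
    rw [← mul_assoc, mul_comm (1 / 2 : ℝ), mul_assoc,
      ← hf.hDeriv_const_mul hz (hf.dy_dy_smooth l j)]
    rfl
  have h3 := hf.vert_dy hz (fun m => nonlinCoeff f m j) l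
  rw [hf.sum_mul_hDeriv_fundTensor hz, hf.sum_mul_hDeriv_fundTensor hz, h2]
  linarith [hf.alongDx_dy_dy hz l j]

theorem cartanTorsion_eqOn (hf : IsLocalFinsler U f) (i j k : Fin n) :
    Set.EqOn (cartanTorsion f i j k)
      (fun w => (1 / 4) * dy k (dy j (dy i (energy f))) w) (slitOver U) := fun z hz => by
  have hΩ := hf.isOpen_slit
  have h : dy k (fundTensor f i j) z = (1 / 2) * dy k (dy i (dy j (energy f))) z :=
    dy_const_mul hΩ (hf.dy_dy_smooth j i) hz _ _
  rw [cartanTorsion, h,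
    eqOn_dy hΩ (fun z hz => dy_dy_comm hΩ hf.energy_smooth hz i j) k hz]
  ring

/-- The contraction of the Landsberg curvature against the Berwald connection:
`L_ijk = yˢ ∂C_ijk/∂xˢ - 2Gᵐ ∂C_ijk/∂yᵐ - Nᵐ_i C_mjk - Nᵐ_j C_imk - Nᵐ_k C_ijm`. -/
theorem landsberg_eq_dynamical (hf : IsLocalFinsler U f) (hz : z ∈ slitOver U) (i j k : Fin n) :
    4 * landsberg f i j k z = alongDx (dy k (dy j (dy i (energy f)))) z
      - 2 * vert (sprayCoeff f) (dy k (dy j (dy i (energy f)))) z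
      - vert (fun m => nonlinCoeff f m i) (dy k (dy j (energy f))) z
      - vert (fun m => nonlinCoeff f m j) (dy k (dy i (energy f))) z
      - vert (fun m => nonlinCoeff f m k) (dy j (dy i (energy f))) z := by
  have hΩ := hf.isOpen_slit
  have hcomm := fun (i j : Fin n) => dy_dy_comm hΩ (hf.dy_smooth i) hz
  have hsm := contDiffOn_dy hΩ (hf.dy_dy_smooth i j) k
  have h1 : ∀ s, hDeriv f s (cartanTorsion f i j k) z
      = (1 / 4) * hDeriv f s (dy k (dy j (dy i (energy f)))) z := fun s => by
    rw [← hf.hDeriv_const_mul hz hsm]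
    simp only [hDeriv, eqOn_dx hΩ (hf.cartanTorsion_eqOn i j k) s hz,
      eqOn_dy hΩ (hf.cartanTorsion_eqOn i j k) _ hz]
  have h2 : ∀ (T : Fin n → ℝ) (a : Fin n),
      ∑ s, z.2 s * ∑ m, cartanGamma f m a s z * T m = ∑ m, nonlinCoeff f m a z * T m := by
    intro T a
    simp only [Finset.mul_sum]
    rw [Finset.sum_comm]
    refine Finset.sum_congr rfl fun m _ => ?_
    rw [← hf.sum_mul_cartanGamma hz, Finset.sum_mul]
    simp only [mul_assoc]
  have h3 : landsberg f i j k z =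
      (1 / 4) * ∑ s, z.2 s * hDeriv f s (dy k (dy j (dy i (energy f)))) z
      - (∑ m, nonlinCoeff f m i z * cartanTorsion f m j k z
        + ∑ m, nonlinCoeff f m j z * cartanTorsion f i m k z
        + ∑ m, nonlinCoeff f m k z * cartanTorsion f i j m z) := by
    rw [← h2, ← h2, ← h2, Finset.mul_sum, ← Finset.sum_add_distrib, ← Finset.sum_add_distrib,
      ← Finset.sum_sub_distrib]
    refine Finset.sum_congr rfl fun s _ => ?_
    rw [cartanTorsionH, h1]
    simp only [Finset.sum_add_distrib]
    ring
  have h4 : ∑ m, nonlinCoeff f m i z * cartanTorsion f m j k z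
      = (1 / 4) * vert (fun m => nonlinCoeff f m i) (dy k (dy j (energy f))) z := by
    rw [vert, Finset.mul_sum]
    refine Finset.sum_congr rfl fun m _ => ?_
    rw [hf.cartanTorsion_eqOn m j k hz, dy_dy_comm hΩ (hf.dy_smooth j) hz m k,
      eqOn_dy hΩ (fun z hz => dy_dy_comm hΩ hf.energy_smooth hz m j) k hz]
    ring
  have h5 : ∑ m, nonlinCoeff f m j z * cartanTorsion f i m k z
      = (1 / 4) * vert (fun m => nonlinCoeff f m j) (dy k (dy i (energy f))) z := by
    rw [vert, Finset.mul_sum]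
    refine Finset.sum_congr rfl fun m _ => ?_
    rw [hf.cartanTorsion_eqOn i m k hz, dy_dy_comm hΩ (hf.dy_smooth i) hz m k]
    ring
  have h6 : ∑ m, nonlinCoeff f m k z * cartanTorsion f i j m z
      = (1 / 4) * vert (fun m => nonlinCoeff f m k) (dy j (dy i (energy f))) z := by
    rw [vert, Finset.mul_sum]
    refine Finset.sum_congr rfl fun m _ => ?_
    rw [hf.cartanTorsion_eqOn i j m hz]
    ring
  rw [h3, h4, h5, h6, hf.sum_mul_hDeriv hz]
  ring

/-- `L_ijk = -½ y_m Bᵐ_ijk`: the Landsberg curvature is a contraction of the Berwald curvature. -/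
theorem landsberg_eq (hf : IsLocalFinsler U f) (hz : z ∈ slitOver U) (i j k : Fin n) :
    landsberg f i j k z = -(1 / 4) * ∑ m, berwaldCurv f m i j k z * dy m (energy f) z := by
  have hΩ := hf.isOpen_slit
  -- The second and third vertical derivatives of the spray are symmetric.
  have hs : ∀ a b φ, vert (fun m => dy a (nonlinCoeff f m b)) φ z
      = vert (fun m => dy b (nonlinCoeff f m a)) φ z := fun a b φ =>
    Finset.sum_congr rfl fun m _ => by
      change dy a (dy b (sprayCoeff f m)) z * _ = dy b (dy a (sprayCoeff f m)) z * _
      rw [dy_dy_comm hΩ (hf.spray_smooth m) hz]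
  have ht1 : vert (fun m => dy k (dy i (nonlinCoeff f m j))) (energy f) z
      = vert (fun m => dy k (dy j (nonlinCoeff f m i))) (energy f) z :=
    Finset.sum_congr rfl fun m _ => by
      change dy k (dy i (dy j (sprayCoeff f m))) z * _ = dy k (dy j (dy i (sprayCoeff f m))) z * _
      rw [eqOn_dy hΩ (fun z hz => dy_dy_comm hΩ (hf.spray_smooth m) hz i j) k hz]
  have ht2 : vert (fun m => dy j (dy i (nonlinCoeff f m k))) (energy f) z
      = vert (fun m => dy k (dy j (nonlinCoeff f m i))) (energy f) z :=
    Finset.sum_congr rfl fun m _ => by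
      change dy j (dy i (dy k (sprayCoeff f m))) z * _ = dy k (dy j (dy i (sprayCoeff f m))) z * _
      rw [eqOn_dy hΩ (fun z hz => dy_dy_comm hΩ (hf.spray_smooth m) hz i k) j hz,
        dy_dy_comm hΩ (contDiffOn_dy hΩ (hf.spray_smooth m) i) hz]
  have hb : ∑ m, berwaldCurv f m i j k z * dy m (energy f) z
      = vert (fun m => dy k (dy j (nonlinCoeff f m i))) (energy f) z := rfl
  have h0 := hf.landsberg_eq_dynamical hz i j k
  have h1 := hf.alongDx_dy_dy_dy hz i j k
  have h2 := hf.dx_dy_dy_energy hz i j k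
  have h3 := hf.dx_dy_dy_energy hz j i k
  have h4 := hf.dx_dy_dy_energy hz k i j
  rw [ht1, hs i j] at h3
  rw [ht2, hs i k, hs j k] at h4
  rw [hb]
  linarith

theorem landsberg_smooth (hf : IsLocalFinsler U f) (i j k : Fin n) :
    ContDiffOn ℝ ∞ (landsberg f i j k) (slitOver U) := by
  have hΩ := hf.isOpen_slit
  refine ContDiffOn.congr ?_ fun z hz => hf.landsberg_eq hz i j k
  exact contDiffOn_const.mul (ContDiffOn.sum fun m _ => (contDiffOn_dy hΩ (contDiffOn_dy hΩ
    (contDiffOn_dy hΩ (hf.spray_smooth m) i) j) k).mul (hf.dy_smooth m))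

theorem landsbergUp_smooth (hf : IsLocalFinsler U f) (i j k : Fin n) :
    ContDiffOn ℝ ∞ (landsbergUp f i j k) (slitOver U) :=
  ContDiffOn.sum fun l _ => (hf.fundInv_smooth i l).mul (hf.landsberg_smooth l j k)

end IsLocalFinsler

end LocalFinsler

/-! ### Linear algebra at a point -/

section LinearAlgebra

open Matrix

variable {n : ℕ}

theorem exists_ne_zero_dotProduct_eq_zero (hn : 3 ≤ n) (a b : Fin n → ℝ) :
    ∃ v : Fin n → ℝ, v ≠ 0 ∧ a ⬝ᵥ v = 0 ∧ b ⬝ᵥ v = 0 := by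
  have h := LinearMap.ker_ne_bot_of_finrank_lt
    (f := (Matrix.of ![a, b] : Matrix (Fin 2) (Fin n) ℝ).mulVecLin) (by simp; omega)
  obtain ⟨v, hv, hv0⟩ := (Submodule.ne_bot_iff _).1 h
  have h0 : ∀ i, (Matrix.of ![a, b] *ᵥ v) i = 0 := fun i => by
    simpa using congrFun (LinearMap.mem_ker.1 hv) i
  exact ⟨v, hv0, by simpa [Matrix.mulVec] using h0 0, by simpa [Matrix.mulVec] using h0 1⟩

/-- The matrix form of the comparison of two curvatures whose connections differ by `g⁻¹M`, with
`M` symmetric and `g` parallel. Here `A`, `B` are the values of the connection form on two vectors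
`X`, `Y`, `lX`, `lY` those of `g⁻¹M`, and `dX`, `dY` the derivatives of `lY` along `X` and of `lX`
along `Y`; `hSX`, `hSY` state that the derivatives of the symmetric matrices `g * lY`, `g * lX` are
symmetric, `g` being parallel. With the index lowered by `g`, the part of the difference which is
linear in `M` is symmetric and the quadratic part is antisymmetric, so that each vanishes. -/
theorem mul_comm_of_curvature_eq {g A B lX lY dX dY : Matrix (Fin n) (Fin n) ℝ} (hg : gᵀ = g)
    (hX : (g * lX)ᵀ = g * lX) (hY : (g * lY)ᵀ = g * lY)
    (hSX : ((Aᵀ * g + g * A) * lY + g * dX)ᵀ = (Aᵀ * g + g * A) * lY + g * dX)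
    (hSY : ((Bᵀ * g + g * B) * lX + g * dY)ᵀ = (Bᵀ * g + g * B) * lX + g * dY)
    (h : dX - dY - (B * lX + lY * A + lY * lX - A * lY - lX * B - lX * lY) = 0) :
    g * lX * lY = g * lY * lX := by
  set SX := (Aᵀ * g + g * A) * lY + g * dX with hSXd
  set SY := (Bᵀ * g + g * B) * lX + g * dY with hSYd
  have hX' : lXᵀ * g = g * lX := by rw [← hX, transpose_mul, hg]
  have hY' : lYᵀ * g = g * lY := by rw [← hY, transpose_mul, hg]
  have h1 : (SX - SY - Aᵀ * (g * lY) - g * lY * A + Bᵀ * (g * lX) + g * lX * B)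
      + (g * lX * lY - g * lY * lX) = 0 := by
    have h2 : g * (dX - dY - (B * lX + lY * A + lY * lX - A * lY - lX * B - lX * lY)) = 0 := by
      rw [h, mul_zero]
    rw [← h2, hSXd, hSYd]
    noncomm_ring
  have h2 := congrArg transpose h1
  simp only [transpose_add, transpose_sub, transpose_mul, transpose_transpose, hSX, hSY, hg, hX',
    hY', transpose_zero] at h2
  have e1 : lYᵀ * (g * lX) = g * lY * lX := by rw [← mul_assoc, hY']
  have e2 : lXᵀ * (g * lY) = g * lX * lY := by rw [← mul_assoc, hX']
  rw [e1, e2] at h2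
  have h3 : (2 : ℝ) • (g * lX * lY - g * lY * lX) = 0 := by
    rw [two_smul]
    calc _ = ((SX - SY - Aᵀ * (g * lY) - g * lY * A + Bᵀ * (g * lX) + g * lX * B)
          + (g * lX * lY - g * lY * lX)) - (SX - SY - g * lY * A - Aᵀ * (g * lY)
          + g * lX * B + Bᵀ * (g * lX) + (g * lY * lX - g * lX * lY)) := by abel
      _ = 0 := by rw [h1, h2, sub_zero]
  exact sub_eq_zero.1 ((smul_eq_zero.1 h3).resolve_left two_ne_zero)

/-- If the matrices `½ (u(ξ) h + hξ ⊗ u + u ⊗ hξ)`, where `h = g - p ⊗ p` is an angular metric,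
commute with respect to `g`, then `u = 0` in dimension at least `3`. -/
theorem eq_zero_of_commute (hn : 3 ≤ n) {g : Matrix (Fin n) (Fin n) ℝ} (hg : g.PosDef)
    {u p y : Fin n → ℝ} {c : ℝ} (hc : c ≠ 0) (hy : g *ᵥ y = c • p) (hu : u ⬝ᵥ y = 0)
    {M : (Fin n → ℝ) → Matrix (Fin n) (Fin n) ℝ}
    (hM : ∀ ξ η, M ξ *ᵥ η = (1 / 2 : ℝ) • ((u ⬝ᵥ ξ) • (g *ᵥ η - (p ⬝ᵥ η) • p)
      + (u ⬝ᵥ η) • (g *ᵥ ξ - (p ⬝ᵥ ξ) • p) + (η ⬝ᵥ (g *ᵥ ξ - (p ⬝ᵥ ξ) • p)) • u))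
    (hMt : ∀ ξ, (M ξ)ᵀ = M ξ)
    (hcomm : ∀ ξ η, M ξ * (g⁻¹ * M η) = M η * (g⁻¹ * M ξ)) : u = 0 := by
  have hdet : IsUnit g.det := hg.det_pos.ne'.isUnit
  have hgt : gᵀ = g := (by simpa using hg.isHermitian : g.IsSymm)
  obtain ⟨v, hv0, huv, hpv⟩ := exists_ne_zero_dotProduct_eq_zero hn u p
  -- `N` is `u` with its index raised; it is tangent to the indicatrix because `u(y) = 0`.
  set N := g⁻¹ *ᵥ u with hN
  have hgN : g *ᵥ N = u := by rw [hN, mulVec_mulVec, mul_nonsing_inv _ hdet, one_mulVec]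
  have hgsymm : ∀ a b : Fin n → ℝ, a ⬝ᵥ (g *ᵥ b) = (g *ᵥ a) ⬝ᵥ b := fun a b => by
    rw [dotProduct_mulVec, ← mulVec_transpose, hgt]
  have hpN : p ⬝ᵥ N = 0 := by
    have : c * (p ⬝ᵥ N) = 0 := by
      rw [← smul_eq_mul, ← smul_dotProduct, ← hy, ← hgsymm, hgN, dotProduct_comm, hu]
    exact (mul_eq_zero.1 this).resolve_left hc
  have hvpos : 0 < v ⬝ᵥ (g *ᵥ v) := by simpa using hg.dotProduct_mulVec_pos hv0
  have hNv : N ⬝ᵥ (g *ᵥ v) = 0 := by rw [hgsymm, hgN, huv]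
  have hvu : v ⬝ᵥ u = 0 := by rw [dotProduct_comm, huv]
  have hNu : N ⬝ᵥ u = u ⬝ᵥ N := dotProduct_comm _ _
  set q := u ⬝ᵥ N with hq
  set r := v ⬝ᵥ (g *ᵥ v) with hr
  have m1 : M N *ᵥ N = (3 / 2 * q) • u := by
    rw [hM, hgN, hpN]; ext i; simp [hNu, ← hq]; ring
  have m2 : M v *ᵥ v = (r / 2) • u := by
    rw [hM, huv, hpv]; ext i; simp [← hr]; ring
  have m3 : M N *ᵥ v = (q / 2) • (g *ᵥ v) := by
    rw [hM, hgN, hpN, hpv, huv]; ext i; simp [hvu, ← hq]; ring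
  have m4 : M v *ᵥ N = (q / 2) • (g *ᵥ v) := by
    rw [hM, hpN, hpv, huv]; ext i; simp [hNv, ← hq]; ring
  have h1 : ∀ a b x w : Fin n → ℝ, x ⬝ᵥ ((M a * (g⁻¹ * M b)) *ᵥ w)
      = (M a *ᵥ x) ⬝ᵥ (g⁻¹ *ᵥ (M b *ᵥ w)) := fun a b x w => by
    rw [← mulVec_mulVec, ← mulVec_mulVec, dotProduct_mulVec, ← mulVec_transpose, hMt]
  have h2 := h1 N v N v
  rw [hcomm, h1, m1, m2, m3, m4] at h2
  have hgi : g⁻¹ *ᵥ (g *ᵥ v) = v := by rw [mulVec_mulVec, nonsing_inv_mul _ hdet, one_mulVec]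
  simp only [mulVec_smul, hgi, ← hN, smul_dotProduct, dotProduct_smul, smul_eq_mul,
    dotProduct_comm (g *ᵥ v) v, ← hr, ← hq] at h2
  have h3 : q = 0 := by
    have : q * q * r = 0 := by linarith
    simpa [hvpos.ne'] using this
  by_contra hu0
  have hN0 : N ≠ 0 := fun h => hu0 (by rw [← hgN, h, mulVec_zero])
  have : 0 < N ⬝ᵥ (g *ᵥ N) := by simpa using hg.dotProduct_mulVec_pos hN0
  rw [hgN, hNu, h3] at this
  exact lt_irrefl _ this

end LinearAlgebra

/-! ### Functions that are polynomial along the fibres -/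

section FibrePoly

variable {n : ℕ} {Ω : Set (Coord n × Coord n)} {φ ψ : Coord n × Coord n → ℝ}
  {z : Coord n × Coord n}

/-- `φ` is smooth and locally a polynomial of degree at most `d` in `y`: its vertical derivatives
of order `d + 1` vanish. -/
def FibrePoly (Ω : Set (Coord n × Coord n)) : ℕ → (Coord n × Coord n → ℝ) → Prop
  | 0, φ => ContDiffOn ℝ ∞ φ Ω ∧ ∀ i, ∀ z ∈ Ω, dy i φ z = 0
  | d + 1, φ => ContDiffOn ℝ ∞ φ Ω ∧ ∀ i, FibrePoly Ω d (dy i φ)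

namespace FibrePoly

theorem smooth {d : ℕ} (h : FibrePoly Ω d φ) : ContDiffOn ℝ ∞ φ Ω := by
  cases d <;> exact h.1

theorem congr (hΩ : IsOpen Ω) {d : ℕ} (h : FibrePoly Ω d φ) (he : Set.EqOn ψ φ Ω) :
    FibrePoly Ω d ψ := by
  induction d generalizing φ ψ with
  | zero => exact ⟨h.1.congr he, fun i z hz => by rw [eqOn_dy hΩ he i hz, h.2 i z hz]⟩
  | succ d ih => exact ⟨h.1.congr he, fun i => ih (h.2 i) (eqOn_dy hΩ he i)⟩

theorem zero (hΩ : IsOpen Ω) {d : ℕ} (h : ∀ z ∈ Ω, φ z = 0) : FibrePoly Ω d φ := by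
  have h0 : ∀ i : Fin n, dy i (fun _ => (0 : ℝ)) = fun _ => 0 := fun i => by ext z; simp [dy]
  have : FibrePoly Ω d (fun _ => (0 : ℝ)) := by
    induction d with
    | zero => exact ⟨contDiffOn_const, fun i z _ => by rw [h0]⟩
    | succ d ih => exact ⟨contDiffOn_const, fun i => by rw [h0]; exact ih⟩
  exact this.congr hΩ h

theorem succ (hΩ : IsOpen Ω) {d : ℕ} (h : FibrePoly Ω d φ) : FibrePoly Ω (d + 1) φ := by
  induction d generalizing φ with
  | zero => exact ⟨h.1, fun i => zero hΩ (h.2 i)⟩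
  | succ d ih => exact ⟨h.1, fun i => ih (h.2 i)⟩

theorem add (hΩ : IsOpen Ω) {d : ℕ} (h : FibrePoly Ω d φ) (h' : FibrePoly Ω d ψ) :
    FibrePoly Ω d (fun w => φ w + ψ w) := by
  induction d generalizing φ ψ with
  | zero => exact ⟨h.1.add h'.1, fun i z hz => by
      rw [dy_add hΩ h.1 h'.1 hz, h.2 i z hz, h'.2 i z hz, add_zero]⟩
  | succ d ih => exact ⟨h.1.add h'.1, fun i => (ih (h.2 i) (h'.2 i)).congr hΩ
      fun z hz => dy_add hΩ h.1 h'.1 hz i⟩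

theorem const_mul (hΩ : IsOpen Ω) {d : ℕ} (h : FibrePoly Ω d φ) (c : ℝ) :
    FibrePoly Ω d (fun w => c * φ w) := by
  induction d generalizing φ with
  | zero => exact ⟨contDiffOn_const.mul h.1, fun i z hz => by
      rw [dy_const_mul hΩ h.1 hz, h.2 i z hz, mul_zero]⟩
  | succ d ih => exact ⟨contDiffOn_const.mul h.1, fun i => (ih (h.2 i)).congr hΩ
      fun z hz => dy_const_mul hΩ h.1 hz c i⟩

theorem sub (hΩ : IsOpen Ω) {d : ℕ} (h : FibrePoly Ω d φ) (h' : FibrePoly Ω d ψ) :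
    FibrePoly Ω d (fun w => φ w - ψ w) :=
  (h.add hΩ (h'.const_mul hΩ (-1))).congr hΩ fun z _ => by ring

theorem sum (hΩ : IsOpen Ω) {ι : Type*} {s : Finset ι} {d : ℕ}
    {A : ι → Coord n × Coord n → ℝ} (h : ∀ m, FibrePoly Ω d (A m)) :
    FibrePoly Ω d (fun w => ∑ m ∈ s, A m w) := by
  classical
  induction s using Finset.induction_on with
  | empty => exact zero hΩ fun z _ => by simp
  | insert m s hm ih => exact ((h m).add hΩ ih).congr hΩ fun z _ => by simp [hm]

theorem mul (hΩ : IsOpen Ω) : ∀ {d e k : ℕ} {φ ψ : Coord n × Coord n → ℝ},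
    FibrePoly Ω d φ → FibrePoly Ω e ψ → d + e = k → FibrePoly Ω k (fun w => φ w * ψ w)
  | 0, 0, k, φ, ψ, h, h', hk => by
    obtain rfl : 0 = k := hk
    exact ⟨h.1.mul h'.1, fun i z hz => by
      rw [dy_mul hΩ h.1 h'.1 hz, h.2 i z hz, h'.2 i z hz]; ring⟩
  | 0, e + 1, k, φ, ψ, h, h', hk => by
    obtain rfl : e + 1 = k := by omega
    exact ⟨h.1.mul h'.1, fun i => (mul hΩ h (h'.2 i) (by omega)).congr hΩ fun z hz => by
      rw [dy_mul hΩ h.1 h'.1 hz, h.2 i z hz]; ring⟩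
  | d + 1, 0, k, φ, ψ, h, h', hk => by
    obtain rfl : d + 1 = k := by omega
    exact ⟨h.1.mul h'.1, fun i => (mul hΩ (h.2 i) h' (by omega)).congr hΩ fun z hz => by
      rw [dy_mul hΩ h.1 h'.1 hz, h'.2 i z hz]; ring⟩
  | d + 1, e + 1, k, φ, ψ, h, h', hk => by
    obtain rfl : d + e + 1 + 1 = k := by omega
    exact ⟨h.1.mul h'.1, fun i => ((mul hΩ (h.2 i) h' (by omega)).add hΩ
      (mul hΩ h (h'.2 i) (by omega))).congr hΩ fun z hz => dy_mul hΩ h.1 h'.1 hz i⟩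

theorem dx (hΩ : IsOpen Ω) {d : ℕ} (h : FibrePoly Ω d φ) (i : Fin n) :
    FibrePoly Ω d (dx i φ) := by
  induction d generalizing φ with
  | zero =>
    refine ⟨contDiffOn_dx hΩ h.1 i, fun j z hz => ?_⟩
    rw [← dx_dy_comm hΩ h.1 hz, eqOn_dx hΩ (h.2 j) i hz]; simp [FinslerGeom.dx]
  | succ d ih =>
    exact ⟨contDiffOn_dx hΩ h.1 i, fun j => (ih (h.2 j)).congr hΩ fun z hz =>
      (dx_dy_comm hΩ h.1 hz i j).symm⟩

theorem snd_apply (m : Fin n) :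
    FibrePoly Ω 1 (fun w : Coord n × Coord n => w.2 m) := by
  refine ⟨contDiffOn_snd_apply m, fun i => ?_⟩
  have h : dy i (fun w : Coord n × Coord n => w.2 m) = fun _ => if m = i then 1 else 0 := by
    ext z; exact dy_snd_apply i m z
  rw [h]
  exact ⟨contDiffOn_const, fun j z _ => by simp [dy]⟩

theorem alongDx (hΩ : IsOpen Ω) {d : ℕ} (h : FibrePoly Ω d φ) :
    FibrePoly Ω (d + 1) (alongDx φ) :=
  sum hΩ fun m => (snd_apply m).mul hΩ (h.dx hΩ m) (by omega)

theorem vert (hΩ : IsOpen Ω) {d e : ℕ} {A : Fin n → Coord n × Coord n → ℝ}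
    (hA : ∀ m, FibrePoly Ω d (A m)) (h : FibrePoly Ω (e + 1) φ) :
    FibrePoly Ω (d + e) (vert A φ) :=
  sum hΩ fun m => (hA m).mul hΩ (h.2 m) rfl

theorem comp_fst {U : Set (Coord n)} (hU : IsOpen U) {c : Coord n → ℝ}
    (hc : ContDiffOn ℝ ∞ c U) : FibrePoly (slitOver U) 0 (fun w => c w.1) :=
  ⟨hc.comp contDiff_fst.contDiffOn fun _ hz => hz.1, fun i _ hz =>
    dy_comp_fst ((hc.contDiffAt (hU.mem_nhds hz.1)).differentiableAt (by simp)) i⟩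

theorem dy_dy_eq_zero (h : FibrePoly Ω 1 φ) (hz : z ∈ Ω) (i j : Fin n) :
    dy j (dy i φ) z = 0 := (h.2 i).2 j z hz

theorem dy_dy_dy_eq_zero (h : FibrePoly Ω 2 φ) (hz : z ∈ Ω) (i j k : Fin n) :
    dy k (dy j (dy i φ)) z = 0 := ((h.2 i).2 j).2 k z hz

end FibrePoly

theorem dy_dy_mul (hΩ : IsOpen Ω) (hφ : ContDiffOn ℝ ∞ φ Ω) (hψ : ContDiffOn ℝ ∞ ψ Ω)
    (hz : z ∈ Ω) (i j : Fin n) :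
    dy j (dy i (fun w => φ w * ψ w)) z = dy j (dy i φ) z * ψ z + dy i φ z * dy j ψ z
      + dy j φ z * dy i ψ z + φ z * dy j (dy i ψ) z := by
  have hφ1 := contDiffOn_dy hΩ hφ
  have hψ1 := contDiffOn_dy hΩ hψ
  rw [eqOn_dy hΩ (fun z hz => dy_mul hΩ hφ hψ hz i) j hz,
    dy_add hΩ ((hφ1 i).mul hψ) (hφ.mul (hψ1 i)) hz, dy_mul hΩ (hφ1 i) hψ hz,
    dy_mul hΩ hφ (hψ1 i) hz]
  ring

/-- The Leibniz rule for third vertical derivatives. -/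
theorem dy_dy_dy_mul (hΩ : IsOpen Ω) (hφ : ContDiffOn ℝ ∞ φ Ω) (hψ : ContDiffOn ℝ ∞ ψ Ω)
    (hz : z ∈ Ω) (i j k : Fin n) :
    dy k (dy j (dy i (fun w => φ w * ψ w))) z = dy k (dy j (dy i φ)) z * ψ z
      + dy j (dy i φ) z * dy k ψ z + dy k (dy i φ) z * dy j ψ z + dy k (dy j φ) z * dy i ψ z
      + dy i φ z * dy k (dy j ψ) z + dy j φ z * dy k (dy i ψ) z + dy k φ z * dy j (dy i ψ) z
      + φ z * dy k (dy j (dy i ψ)) z := by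
  have hφ1 := contDiffOn_dy hΩ hφ
  have hψ1 := contDiffOn_dy hΩ hψ
  rw [eqOn_dy hΩ (eqOn_dy hΩ (fun z hz => dy_mul hΩ hφ hψ hz i) j) k hz,
    eqOn_dy hΩ (fun z hz => dy_add hΩ ((hφ1 i).mul hψ) (hφ.mul (hψ1 i)) hz j) k hz,
    dy_add hΩ (contDiffOn_dy hΩ ((hφ1 i).mul hψ) j) (contDiffOn_dy hΩ (hφ.mul (hψ1 i)) j) hz,
    dy_dy_mul hΩ (hφ1 i) hψ hz, dy_dy_mul hΩ hφ (hψ1 i) hz]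
  ring

/-- The third vertical derivative of `φ ψ` for `ψ` linear along the fibres. -/
theorem dy_dy_dy_mul_of_linear (hΩ : IsOpen Ω) (hφ : ContDiffOn ℝ ∞ φ Ω) (hψ : FibrePoly Ω 1 ψ)
    (hz : z ∈ Ω) (i j k : Fin n) :
    dy k (dy j (dy i (fun w => φ w * ψ w))) z = dy k (dy j (dy i φ)) z * ψ z
      + dy j (dy i φ) z * dy k ψ z + dy k (dy i φ) z * dy j ψ z + dy k (dy j φ) z * dy i ψ z := by
  rw [dy_dy_dy_mul hΩ hφ hψ.smooth hz, (hψ.succ hΩ).dy_dy_dy_eq_zero hz, hψ.dy_dy_eq_zero hz,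
    hψ.dy_dy_eq_zero hz, hψ.dy_dy_eq_zero hz]
  ring

end FibrePoly

/-! ### The spray and the Landsberg curvature of a Randers metric -/

section Randers

variable {n : ℕ}

namespace IsLocalFinsler

variable {U : Set (Coord n)} {f : Coord n × Coord n → ℝ} {z : Coord n × Coord n}

theorem energy_eqOn (f : Coord n × Coord n → ℝ) (s : Set (Coord n × Coord n)) :
    Set.EqOn (energy f) (fun w => f w * f w) s := fun z _ => by simp [energy, sq]

theorem dx_energy_eq (hf : IsLocalFinsler U f) (hz : z ∈ slitOver U) (l : Fin n) :
    dx l (energy f) z = 2 * (f z * dx l f z) := by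
  rw [eqOn_dx hf.isOpen_slit (energy_eqOn f _) l hz, dx_mul hf.isOpen_slit hf.smooth hf.smooth hz]
  ring

theorem dy_energy_eq (hf : IsLocalFinsler U f) (hz : z ∈ slitOver U) (l : Fin n) :
    dy l (energy f) z = 2 * (f z * dy l f z) := by
  rw [eqOn_dy hf.isOpen_slit (energy_eqOn f _) l hz, dy_mul hf.isOpen_slit hf.smooth hf.smooth hz]
  ring

theorem dy_dy_energy_eq (hf : IsLocalFinsler U f) (hz : z ∈ slitOver U) (i l : Fin n) :
    dy i (dy l (energy f)) z = 2 * (dy i f z * dy l f z + f z * dy i (dy l f) z) := by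
  have hΩ := hf.isOpen_slit
  have h1 := contDiffOn_dy hΩ hf.smooth l
  rw [eqOn_dy hΩ (fun z hz => hf.dy_energy_eq hz l) i hz,
    dy_const_mul hΩ (hf.smooth.mul h1) hz, dy_mul hΩ hf.smooth h1 hz]

theorem dx_dy_energy_eq (hf : IsLocalFinsler U f) (hz : z ∈ slitOver U) (i l : Fin n) :
    dx i (dy l (energy f)) z = 2 * (dx i f z * dy l f z + f z * dx i (dy l f) z) := by
  have hΩ := hf.isOpen_slit
  have h1 := contDiffOn_dy hΩ hf.smooth l
  rw [eqOn_dx hΩ (fun z hz => hf.dy_energy_eq hz l) i hz,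
    dx_const_mul hΩ (hf.smooth.mul h1) hz, dx_mul hΩ hf.smooth h1 hz]

theorem vert_energy_eq (hf : IsLocalFinsler U f) (hz : z ∈ slitOver U)
    (A : Fin n → Coord n × Coord n → ℝ) : vert A (energy f) z = 2 * (f z * vert A f z) := by
  simp only [vert, hf.dy_energy_eq hz, Finset.mul_sum]
  exact Finset.sum_congr rfl fun _ _ => by ring

theorem vert_dy_energy_eq (hf : IsLocalFinsler U f) (hz : z ∈ slitOver U)
    (A : Fin n → Coord n × Coord n → ℝ) (l : Fin n) :
    vert A (dy l (energy f)) z = 2 * (vert A f z * dy l f z + f z * vert A (dy l f) z) := by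
  simp only [vert, hf.dy_dy_energy_eq hz, Finset.mul_sum, Finset.sum_mul,
    ← Finset.sum_add_distrib]
  exact Finset.sum_congr rfl fun _ _ => by ring

theorem alongDx_energy_eq (hf : IsLocalFinsler U f) (hz : z ∈ slitOver U) :
    alongDx (energy f) z = 2 * (f z * alongDx f z) := by
  simp only [alongDx, hf.dx_energy_eq hz, Finset.mul_sum]
  exact Finset.sum_congr rfl fun _ _ => by ring

theorem alongDx_dy_energy_eq (hf : IsLocalFinsler U f) (hz : z ∈ slitOver U) (l : Fin n) :
    alongDx (dy l (energy f)) z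
      = 2 * (alongDx f z * dy l f z + f z * alongDx (dy l f) z) := by
  simp only [alongDx, hf.dx_dy_energy_eq hz, Finset.mul_sum, Finset.sum_mul,
    ← Finset.sum_add_distrib]
  exact Finset.sum_congr rfl fun _ _ => by ring

theorem alongDx_eq (hf : IsLocalFinsler U f) (hz : z ∈ slitOver U) (h0 : f z ≠ 0) :
    alongDx f z = 2 * vert (sprayCoeff f) f z := by
  have h := hf.alongDx_energy hz
  rw [hf.alongDx_energy_eq hz, hf.vert_energy_eq hz] at h
  exact mul_left_cancel₀ h0 (by linarith)

theorem alongDx_dy_eq (hf : IsLocalFinsler U f) (hz : z ∈ slitOver U) (h0 : f z ≠ 0)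
    (l : Fin n) : alongDx (dy l f) z - dx l f z = 2 * vert (sprayCoeff f) (dy l f) z := by
  have h := hf.alongDx_dy hz l
  have h1 := hf.alongDx_eq hz h0
  rw [hf.alongDx_dy_energy_eq hz, hf.vert_dy_energy_eq hz, hf.dx_energy_eq hz, h1] at h
  exact mul_left_cancel₀ h0 (by linarith)

/-- The spray equation holds for `A` as soon as it holds for `F` instead of `F²`. -/
theorem spray_eq_of (hf : IsLocalFinsler U f) (hz : z ∈ slitOver U)
    {A : Fin n → Coord n × Coord n → ℝ} (h : alongDx f z = 2 * vert A f z)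
    (h' : ∀ l, alongDx (dy l f) z - dx l f z = 2 * vert A (dy l f) z) (i : Fin n) :
    sprayCoeff f i z = A i z := by
  refine hf.spray_unique hz (fun l => ?_) i
  rw [hf.alongDx_dy_energy_eq hz, hf.vert_dy_energy_eq hz, hf.dx_energy_eq hz]
  linear_combination 2 * dy l f z * h + 2 * f z * h' l

end IsLocalFinsler

/-- `f = α + β` over `U`, where `f` and `α` are Finsler metrics, `α²` is quadratic and `β` is linear
along the fibres. -/
structure IsRandersPair (U : Set (Coord n)) (α β f : Coord n × Coord n → ℝ) : Prop where
  finsler_alpha : IsLocalFinsler U α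
  finsler : IsLocalFinsler U f
  alpha_pos : ∀ z ∈ slitOver U, 0 < α z
  pos : ∀ z ∈ slitOver U, 0 < f z
  energy_poly : FibrePoly (slitOver U) 2 (energy α)
  beta_poly : FibrePoly (slitOver U) 1 β
  beta_hom : IsEulerHom (slitOver U) 1 β
  eqOn : Set.EqOn f (fun z => α z + β z) (slitOver U)

/-- `r₀₀ = b_{i|j} yⁱ yʲ`, where the bar is the Levi-Civita derivative of `α`. -/
def randersR (α β : Coord n × Coord n → ℝ) (z : Coord n × Coord n) : ℝ :=
  alongDx β z - 2 * vert (sprayCoeff α) β z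

/-- `s_l₀ = ½ (b_{l|k} - b_{k|l}) yᵏ`. -/
def randersS (β : Coord n × Coord n → ℝ) (l : Fin n) (z : Coord n × Coord n) : ℝ :=
  (1 / 2) * (alongDx (dy l β) z - dx l β z)

/-- `sᵐ₀`, the form `s_l₀` with its index raised by `α`. -/
def randersSUp (α β : Coord n × Coord n → ℝ) (m : Fin n) (z : Coord n × Coord n) : ℝ :=
  ∑ l, fundInv α m l z * randersS β l z

/-- `s₀ = b_m sᵐ₀`. -/
def randersSZero (α β : Coord n × Coord n → ℝ) (z : Coord n × Coord n) : ℝ :=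
  vert (randersSUp α β) β z

/-- The factor `P = (r₀₀ - 2 α s₀) / 2F` of the spray `Gᵐ = G_αᵐ + P yᵐ + α sᵐ₀`. -/
def randersP (α β f : Coord n × Coord n → ℝ) (z : Coord n × Coord n) : ℝ :=
  (randersR α β z - 2 * (α z * randersSZero α β z)) * (2 * f z)⁻¹

/-- The covector `u_k = P_k - P α_k / α + s_k₀ / α`, the obstruction to being a Landsberg metric. -/
def randersU (α β f : Coord n × Coord n → ℝ) (k : Fin n) (z : Coord n × Coord n) : ℝ :=
  dy k (randersP α β f) z - randersP α β f z * dy k α z / α z + randersS β k z / α z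

namespace IsRandersPair

variable {U : Set (Coord n)} {α β f : Coord n × Coord n → ℝ} {z : Coord n × Coord n}

theorem isOpen_slit (h : IsRandersPair U α β f) : IsOpen (slitOver U) :=
  h.finsler.isOpen_slit

theorem dx_eq (h : IsRandersPair U α β f) (hz : z ∈ slitOver U) (l : Fin n) :
    dx l f z = dx l α z + dx l β z := by
  rw [eqOn_dx h.isOpen_slit h.eqOn l hz,
    dx_add h.isOpen_slit h.finsler_alpha.smooth h.beta_poly.smooth hz]

theorem dy_eq (h : IsRandersPair U α β f) (hz : z ∈ slitOver U) (l : Fin n) :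
    dy l f z = dy l α z + dy l β z := by
  rw [eqOn_dy h.isOpen_slit h.eqOn l hz,
    dy_add h.isOpen_slit h.finsler_alpha.smooth h.beta_poly.smooth hz]

theorem dy_dy_eq (h : IsRandersPair U α β f) (hz : z ∈ slitOver U) (l i : Fin n) :
    dy i (dy l f) z = dy i (dy l α) z := by
  have hΩ := h.isOpen_slit
  rw [eqOn_dy hΩ (fun z hz => h.dy_eq hz l) i hz,
    dy_add hΩ (contDiffOn_dy hΩ h.finsler_alpha.smooth l)
      (contDiffOn_dy hΩ h.beta_poly.smooth l) hz,
    h.beta_poly.dy_dy_eq_zero hz, add_zero]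

theorem dx_dy_eq (h : IsRandersPair U α β f) (hz : z ∈ slitOver U) (l i : Fin n) :
    dx i (dy l f) z = dx i (dy l α) z + dx i (dy l β) z := by
  have hΩ := h.isOpen_slit
  rw [eqOn_dx hΩ (fun z hz => h.dy_eq hz l) i hz,
    dx_add hΩ (contDiffOn_dy hΩ h.finsler_alpha.smooth l)
      (contDiffOn_dy hΩ h.beta_poly.smooth l) hz]

theorem fundTensor_poly (h : IsRandersPair U α β f) (i j : Fin n) :
    FibrePoly (slitOver U) 0 (fundTensor α i j) :=
  ((h.energy_poly.2 j).2 i).const_mul h.isOpen_slit _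

theorem fundInv_poly (h : IsRandersPair U α β f) (i j : Fin n) :
    FibrePoly (slitOver U) 0 (fundInv α i j) := by
  have hΩ := h.isOpen_slit
  refine ⟨h.finsler_alpha.fundInv_smooth i j, fun k z hz => ?_⟩
  have h1 : ∀ l, Set.EqOn (fun w => ∑ m, fundTensor α l m w * fundInv α m j w)
      (fun _ => if l = j then 1 else 0) (slitOver U) := fun l z hz => by
    have := h.finsler_alpha.sum_fundTensor_mul hz (fun m => if m = j then 1 else 0) l
    simpa using this
  have h2 : ∀ l, ∑ m, fundTensor α l m z * dy k (fundInv α m j) z = 0 := fun l => by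
    have := eqOn_dy hΩ (h1 l) k hz
    rw [dy_sum_mul hΩ (fun m => h.finsler_alpha.fundTensor_smooth l m)
      (fun m => h.finsler_alpha.fundInv_smooth m j) hz] at this
    simp only [(h.fundTensor_poly l _).2 k z hz, zero_mul, Finset.sum_const_zero, zero_add] at this
    rw [this]; simp [dy]
  have h3 := h.finsler_alpha.sum_fundInv_mul hz (fun m => dy k (fundInv α m j) z) i
  simp only [h2, mul_zero, Finset.sum_const_zero] at h3
  exact h3.symm

theorem spray_alpha_poly (h : IsRandersPair U α β f) (m : Fin n) :
    FibrePoly (slitOver U) 2 (sprayCoeff α m) := by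
  have hΩ := h.isOpen_slit
  have h1 : ∀ l, FibrePoly (slitOver U) 2
      (fun z => (1 / 4) * (alongDx (dy l (energy α)) z - dx l (energy α) z)) := fun l =>
    (((h.energy_poly.2 l).alongDx hΩ).sub hΩ (h.energy_poly.dx hΩ l)).const_mul hΩ _
  exact (FibrePoly.sum hΩ fun l => (h.fundInv_poly m l).mul hΩ (h1 l) (by omega)).congr hΩ
    fun z _ => IsLocalFinsler.sprayCoeff_eq α z m

theorem randersR_poly (h : IsRandersPair U α β f) : FibrePoly (slitOver U) 2 (randersR α β) :=
  (h.beta_poly.alongDx h.isOpen_slit).sub h.isOpen_slit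
    ((FibrePoly.vert h.isOpen_slit h.spray_alpha_poly h.beta_poly).const_mul h.isOpen_slit 2)

theorem randersS_poly (h : IsRandersPair U α β f) (l : Fin n) :
    FibrePoly (slitOver U) 1 (randersS β l) :=
  (((h.beta_poly.2 l).alongDx h.isOpen_slit).sub h.isOpen_slit
    (h.beta_poly.dx h.isOpen_slit l)).const_mul h.isOpen_slit _

theorem randersSUp_poly (h : IsRandersPair U α β f) (m : Fin n) :
    FibrePoly (slitOver U) 1 (randersSUp α β m) :=
  FibrePoly.sum h.isOpen_slit fun l =>
    (h.fundInv_poly m l).mul h.isOpen_slit (h.randersS_poly l) rfl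

theorem randersSZero_poly (h : IsRandersPair U α β f) :
    FibrePoly (slitOver U) 1 (randersSZero α β) :=
  FibrePoly.vert h.isOpen_slit h.randersSUp_poly h.beta_poly

theorem randersP_smooth (h : IsRandersPair U α β f) :
    ContDiffOn ℝ ∞ (randersP α β f) (slitOver U) :=
  (h.randersR_poly.smooth.sub (contDiffOn_const.mul
    (h.finsler_alpha.smooth.mul h.randersSZero_poly.smooth))).mul
    ((contDiffOn_const.mul h.finsler.smooth).inv fun z hz => by have := h.pos z hz; positivity)

theorem mul_randersP (h : IsRandersPair U α β f) (hz : z ∈ slitOver U) :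
    f z * randersP α β f z = (1 / 2) * randersR α β z - α z * randersSZero α β z := by
  have := (h.pos z hz).ne'
  rw [randersP]; field_simp

/-- The `2`-form `s` is antisymmetric. -/
theorem sum_mul_randersS (h : IsRandersPair U α β f) (hz : z ∈ slitOver U) :
    ∑ l, z.2 l * randersS β l z = 0 := by
  have hΩ := h.isOpen_slit
  have h1 : ∑ l, z.2 l * alongDx (dy l β) z = alongDx β z := by
    simp only [alongDx, Finset.mul_sum]
    rw [Finset.sum_comm]
    refine Finset.sum_congr rfl fun s _ => ?_
    have := h.beta_hom.dx hΩ h.beta_poly.smooth s z hz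
    simp only [euler, one_mul] at this
    simp only [dx_dy_comm hΩ h.beta_poly.smooth hz, mul_left_comm _ (z.2 s), ← Finset.mul_sum, this]
  simp only [randersS, mul_left_comm _ (1 / 2 : ℝ), ← Finset.mul_sum, mul_sub,
    Finset.sum_sub_distrib, h1]
  simp [alongDx]

theorem dy_randersS (h : IsRandersPair U α β f) (hz : z ∈ slitOver U) (k l : Fin n) :
    dy k (randersS β l) z = (1 / 2) * (dx k (dy l β) z - dx l (dy k β) z) := by
  have hΩ := h.isOpen_slit
  have hβ := h.beta_poly.smooth
  have hl := contDiffOn_dy hΩ hβ l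
  have h1 : dy k (randersS β l) z
      = (1 / 2) * dy k (fun z => alongDx (dy l β) z - dx l β z) z :=
    dy_const_mul hΩ ((contDiffOn_alongDx hΩ hl).sub (contDiffOn_dx hΩ hβ l)) hz _ _
  have h2 : alongDx (dy k (dy l β)) z = 0 :=
    Finset.sum_eq_zero fun m _ => by
      rw [eqOn_dx hΩ (fun z hz => h.beta_poly.dy_dy_eq_zero hz l k) m hz]; simp [dx]
  rw [h1, dy_sub hΩ (contDiffOn_alongDx hΩ hl) (contDiffOn_dx hΩ hβ l) hz, dy_alongDx hΩ hl hz,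
    ← dx_dy_comm hΩ hβ hz, h2, add_zero]

theorem vert_randersSUp_dy_energy (h : IsRandersPair U α β f) (hz : z ∈ slitOver U) (l : Fin n) :
    vert (randersSUp α β) (dy l (energy α)) z = 2 * randersS β l z := by
  rw [h.finsler_alpha.vert_dy hz]
  simp only [randersSUp]
  rw [h.finsler_alpha.sum_fundTensor_mul hz (fun m => randersS β m z)]

theorem vert_randersSUp_energy (h : IsRandersPair U α β f) (hz : z ∈ slitOver U) :
    vert (randersSUp α β) (energy α) z = 0 := by
  rw [← h.finsler_alpha.sum_mul_vert_dy hz]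
  simp only [h.vert_randersSUp_dy_energy hz, mul_left_comm _ (2 : ℝ), ← Finset.mul_sum,
    h.sum_mul_randersS hz, mul_zero]

theorem vert_randersSUp_alpha (h : IsRandersPair U α β f) (hz : z ∈ slitOver U) :
    vert (randersSUp α β) α z = 0 := by
  have h1 := h.vert_randersSUp_energy hz
  rw [h.finsler_alpha.vert_energy_eq hz] at h1
  have := (h.alpha_pos z hz).ne'
  simpa [this] using h1

theorem mul_vert_randersSUp_dy_alpha (h : IsRandersPair U α β f) (hz : z ∈ slitOver U)
    (l : Fin n) : α z * vert (randersSUp α β) (dy l α) z = randersS β l z := by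
  have h1 := h.vert_randersSUp_dy_energy hz l
  rw [h.finsler_alpha.vert_dy_energy_eq hz, h.vert_randersSUp_alpha hz] at h1
  linarith

/-- The spray of a Randers metric. -/
theorem spray_eq (h : IsRandersPair U α β f) (hz : z ∈ slitOver U) (m : Fin n) :
    sprayCoeff f m z = sprayCoeff α m z
      + (randersP α β f z * z.2 m + α z * randersSUp α β m z) := by
  have hΩ := h.isOpen_slit
  have h0 := (h.alpha_pos z hz).ne'
  refine h.finsler.spray_eq_of hz (A := fun m z => sprayCoeff α m z
    + (randersP α β f z * z.2 m + α z * randersSUp α β m z)) ?_ (fun l => ?_) m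
  all_goals
    have hv : ∀ φ, vert (fun m z => sprayCoeff α m z
        + (randersP α β f z * z.2 m + α z * randersSUp α β m z)) φ z
        = vert (sprayCoeff α) φ z + (randersP α β f z * euler φ z
          + α z * vert (randersSUp α β) φ z) := fun φ => by
      simp only [vert, euler, Finset.mul_sum, ← Finset.sum_add_distrib]
      exact Finset.sum_congr rfl fun _ _ => by ring
    rw [hv]
  · have e1 : ∀ A, vert A f z = vert A α z + vert A β z := fun A => by
      simp only [vert, h.dy_eq hz, mul_add, Finset.sum_add_distrib]
    have e2 : alongDx f z = alongDx α z + alongDx β z := by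
      simp only [alongDx, h.dx_eq hz, mul_add, Finset.sum_add_distrib]
    have e3 := h.finsler_alpha.alongDx_eq hz h0
    have e4 := h.finsler.hom z hz
    have e5 := h.mul_randersP hz
    rw [e1, e1, h.vert_randersSUp_alpha hz, e2, e3, e4]
    simp only [randersR, randersSZero] at e5
    linear_combination -2 * e5
  · have e1 : ∀ A, vert A (dy l f) z = vert A (dy l α) z := fun A => by
      simp only [vert, h.dy_dy_eq hz]
    have e2 : alongDx (dy l f) z = alongDx (dy l α) z + alongDx (dy l β) z := by
      simp only [alongDx, h.dx_dy_eq hz, mul_add, Finset.sum_add_distrib]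
    have e3 := h.finsler_alpha.alongDx_dy_eq hz h0 l
    have e4 := h.finsler.hom.dy hΩ h.finsler.smooth l z hz
    have e5 : randersS β l z = (1 / 2) * (alongDx (dy l β) z - dx l β z) := rfl
    rw [e1, e1, e2, h.dx_eq hz, e4, h.mul_vert_randersSUp_dy_alpha hz, e5]
    linear_combination e3

/-- `α α_ijk = -(α_ij α_k + α_ik α_j + α_jk α_i)`, since `α²` is quadratic. -/
theorem alpha_mul_dy_dy_dy (h : IsRandersPair U α β f) (hz : z ∈ slitOver U) (i j k : Fin n) :
    α z * dy k (dy j (dy i α)) z = -(dy j (dy i α) z * dy k α z + dy k (dy i α) z * dy j α z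
      + dy k (dy j α) z * dy i α z) := by
  have hΩ := h.isOpen_slit
  have h1 := h.energy_poly.dy_dy_dy_eq_zero hz i j k
  rw [eqOn_dy hΩ (eqOn_dy hΩ (eqOn_dy hΩ (IsLocalFinsler.energy_eqOn α _) i) j) k hz,
    dy_dy_dy_mul hΩ h.finsler_alpha.smooth h.finsler_alpha.smooth hz] at h1
  linarith

theorem berwald_eq (h : IsRandersPair U α β f) (hz : z ∈ slitOver U) (m i j k : Fin n) :
    berwaldCurv f m i j k z
      = (dy k (dy j (dy i (randersP α β f))) z * z.2 m
        + dy j (dy i (randersP α β f)) z * (if m = k then 1 else 0)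
        + dy k (dy i (randersP α β f)) z * (if m = j then 1 else 0)
        + dy k (dy j (randersP α β f)) z * (if m = i then 1 else 0))
      + (dy k (dy j (dy i α)) z * randersSUp α β m z
        + dy j (dy i α) z * dy k (randersSUp α β m) z
        + dy k (dy i α) z * dy j (randersSUp α β m) z
        + dy k (dy j α) z * dy i (randersSUp α β m) z) := by
  have hΩ := h.isOpen_slit
  have hγ := (h.spray_alpha_poly m).smooth
  have h1 : ContDiffOn ℝ ∞ (fun z => randersP α β f z * z.2 m) (slitOver U) :=
    h.randersP_smooth.mul (contDiffOn_snd_apply m)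
  have h2 : ContDiffOn ℝ ∞ (fun z => α z * randersSUp α β m z) (slitOver U) :=
    h.finsler_alpha.smooth.mul (h.randersSUp_poly m).smooth
  have d1 := contDiffOn_dy hΩ h1
  have d2 := contDiffOn_dy hΩ h2
  have dγ := contDiffOn_dy hΩ hγ
  rw [berwaldCurv, eqOn_dy hΩ (eqOn_dy hΩ (eqOn_dy hΩ (fun z hz => h.spray_eq hz m) i) j) k hz,
    eqOn_dy hΩ (eqOn_dy hΩ (fun z hz => dy_add hΩ hγ (h1.add h2) hz i) j) k hz,
    eqOn_dy hΩ (eqOn_dy hΩ (fun z hz => congrArg (dy i (sprayCoeff α m) z + ·)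
      (dy_add hΩ h1 h2 hz i)) j) k hz,
    eqOn_dy hΩ (fun z hz => dy_add hΩ (dγ i) ((d1 i).add (d2 i)) hz j) k hz,
    eqOn_dy hΩ (fun z hz => congrArg (dy j (dy i (sprayCoeff α m)) z + ·)
      (dy_add hΩ (d1 i) (d2 i) hz j)) k hz,
    dy_add hΩ (contDiffOn_dy hΩ (dγ i) j) ((contDiffOn_dy hΩ (d1 i) j).add
      (contDiffOn_dy hΩ (d2 i) j)) hz,
    dy_add hΩ (contDiffOn_dy hΩ (d1 i) j) (contDiffOn_dy hΩ (d2 i) j) hz,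
    (h.spray_alpha_poly m).dy_dy_dy_eq_zero hz,
    dy_dy_dy_mul_of_linear hΩ h.randersP_smooth (FibrePoly.snd_apply m) hz,
    dy_dy_dy_mul_of_linear hΩ h.finsler_alpha.smooth (h.randersSUp_poly m) hz]
  simp only [dy_snd_apply, zero_add]

/-- `α Σ_m α_m ∂sᵐ₀/∂yᵏ = -s_k₀`. -/
theorem alpha_mul_sum_dy_randersSUp (h : IsRandersPair U α β f) (hz : z ∈ slitOver U)
    (k : Fin n) :
    α z * ∑ m, dy k (randersSUp α β m) z * dy m α z = -randersS β k z := by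
  have hΩ := h.isOpen_slit
  have h1 := eqOn_dy hΩ (fun z hz => h.vert_randersSUp_energy hz) k hz
  rw [dy_vert hΩ (fun m => (h.randersSUp_poly m).smooth) h.finsler_alpha.energy_smooth hz,
    h.vert_randersSUp_dy_energy hz, h.finsler_alpha.vert_energy_eq hz] at h1
  simp only [vert] at h1
  have : dy k (fun _ => (0 : ℝ)) z = 0 := by simp [dy]
  linarith

theorem sum_dy_randersSUp_mul (h : IsRandersPair U α β f) (hz : z ∈ slitOver U) (k : Fin n) :
    ∑ m, dy k (randersSUp α β m) z * dy m β z = dy k (randersSZero α β) z := by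
  have hΩ := h.isOpen_slit
  have h1 : dy k (randersSZero α β) z = _ :=
    dy_vert hΩ (fun m => (h.randersSUp_poly m).smooth) h.beta_poly.smooth hz k
  have h2 : vert (randersSUp α β) (dy k β) z = 0 :=
    Finset.sum_eq_zero fun m _ => by rw [h.beta_poly.dy_dy_eq_zero hz, mul_zero]
  rw [h1, h2, add_zero]; rfl

/-- The Landsberg curvature of a Randers metric is the symmetrized product of its angular metric
`h_ij = F α_ij` and the covector `u`. -/
theorem landsberg_eq (h : IsRandersPair U α β f) (hz : z ∈ slitOver U) (i j k : Fin n) :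
    landsberg f i j k z = (1 / 2) * f z * (dy j (dy i α) z * randersU α β f k z
      + dy k (dy i α) z * randersU α β f j z + dy k (dy j α) z * randersU α β f i z) := by
  have hΩ := h.isOpen_slit
  have hα := h.finsler_alpha.smooth
  have h0 := (h.alpha_pos z hz).ne'
  -- The third derivative of the relation `F P = ½ r₀₀ - α s₀`, in which `r₀₀` drops out.
  have hP : f z * dy k (dy j (dy i (randersP α β f))) z
      + dy i f z * dy k (dy j (randersP α β f)) z + dy j f z * dy k (dy i (randersP α β f)) z
      + dy k f z * dy j (dy i (randersP α β f)) z
      = -(dy k (dy j (dy i α)) z * randersP α β f z + dy j (dy i α) z * dy k (randersP α β f) z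
        + dy k (dy i α) z * dy j (randersP α β f) z + dy k (dy j α) z * dy i (randersP α β f) z)
      - (dy k (dy j (dy i α)) z * randersSZero α β z + dy j (dy i α) z * dy k (randersSZero α β) z
        + dy k (dy i α) z * dy j (randersSZero α β) z
        + dy k (dy j α) z * dy i (randersSZero α β) z) := by
    have hr := h.randersR_poly.const_mul hΩ (1 / 2)
    have hs : ContDiffOn ℝ ∞ (fun z => α z * randersSZero α β z) (slitOver U) :=
      hα.mul h.randersSZero_poly.smooth
    have e := eqOn_dy hΩ (eqOn_dy hΩ (eqOn_dy hΩ (fun z hz => h.mul_randersP hz) i) j) k hz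
    rw [dy_dy_dy_mul hΩ h.finsler.smooth h.randersP_smooth hz,
      eqOn_dy hΩ (eqOn_dy hΩ (fun z hz => dy_sub hΩ hr.smooth hs hz i) j) k hz,
      eqOn_dy hΩ (fun z hz => dy_sub hΩ (hr.2 i).smooth (contDiffOn_dy hΩ hs i) hz j) k hz,
      dy_sub hΩ ((hr.2 i).2 j).smooth (contDiffOn_dy hΩ (contDiffOn_dy hΩ hs i) j) hz,
      hr.dy_dy_dy_eq_zero hz, dy_dy_dy_mul_of_linear hΩ hα h.randersSZero_poly hz,
      eqOn_dy hΩ (fun z hz => h.dy_dy_eq hz i j) k hz, h.dy_dy_eq hz, h.dy_dy_eq hz,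
      h.dy_dy_eq hz] at e
    linarith
  have hT : ∀ k, ∑ m, dy k (randersSUp α β m) z * dy m f z
      = -(randersS β k z / α z) + dy k (randersSZero α β) z := fun k => by
    have e := h.alpha_mul_sum_dy_randersSUp hz k
    simp only [h.dy_eq hz, mul_add, Finset.sum_add_distrib, h.sum_dy_randersSUp_mul hz]
    congr 1
    field_simp
    linarith
  have hT0 : ∑ m, randersSUp α β m z * dy m f z = randersSZero α β z := by
    have e := h.vert_randersSUp_alpha hz
    simp only [vert] at e
    simp only [h.dy_eq hz, mul_add, Finset.sum_add_distrib, e, zero_add]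
    rfl
  have hE : ∑ m, z.2 m * dy m f z = f z := by simpa [euler] using h.finsler.hom z hz
  have hB : ∑ m, berwaldCurv f m i j k z * dy m f z
      = dy k (dy j (dy i (randersP α β f))) z * ∑ m, z.2 m * dy m f z
        + dy j (dy i (randersP α β f)) z * dy k f z + dy k (dy i (randersP α β f)) z * dy j f z
        + dy k (dy j (randersP α β f)) z * dy i f z
        + dy k (dy j (dy i α)) z * ∑ m, randersSUp α β m z * dy m f z
        + dy j (dy i α) z * ∑ m, dy k (randersSUp α β m) z * dy m f z
        + dy k (dy i α) z * ∑ m, dy j (randersSUp α β m) z * dy m f z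
        + dy k (dy j α) z * ∑ m, dy i (randersSUp α β m) z * dy m f z := by
    simp only [h.berwald_eq hz, Finset.mul_sum, add_mul, Finset.sum_add_distrib, mul_assoc,
      ite_mul, one_mul, zero_mul, mul_ite, mul_zero, Finset.sum_ite_eq', Finset.mem_univ, if_true]
    ring
  have hL : landsberg f i j k z
      = -(1 / 2) * f z * ∑ m, berwaldCurv f m i j k z * dy m f z := by
    rw [h.finsler.landsberg_eq hz, Finset.mul_sum, Finset.mul_sum]
    exact Finset.sum_congr rfl fun m _ => by rw [h.finsler.dy_energy_eq hz]; ring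
  have h3 := h.alpha_mul_dy_dy_dy hz i j k
  have h3' : dy k (dy j (dy i α)) z = -(dy j (dy i α) z * dy k α z + dy k (dy i α) z * dy j α z
      + dy k (dy j α) z * dy i α z) / α z := by
    rw [← h3]; field_simp
  rw [hL, hB, hE, hT0, hT, hT, hT]
  simp only [randersU]
  have : f z * dy k (dy j (dy i (randersP α β f))) z = _ := eq_sub_of_add_eq
    (eq_sub_of_add_eq (eq_sub_of_add_eq hP))
  rw [mul_comm (dy k (dy j (dy i (randersP α β f))) z), this, h3']
  field_simp
  ring

end IsRandersPair

end Randers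

/-! ### Randers metrics with vanishing Landsberg curvature -/

section RandersLandsberg

variable {n : ℕ} {U : Set (Coord n)} {φ : Coord n × Coord n → ℝ}

/-- A function with vanishing vertical derivatives is constant on the fibres, since `ℝⁿ ∖ 0` is
connected. -/
theorem FibrePoly.eq_of_fst_eq (hn : 2 ≤ n) (h : FibrePoly (slitOver U) 0 φ) (hU : IsOpen U)
    {x y y' : Coord n} (hx : x ∈ U) (hy : y ≠ 0) (hy' : y' ≠ 0) : φ (x, y) = φ (x, y') := by
  have hrank : 1 < Module.rank ℝ (Coord n) := by
    rw [← Module.finrank_eq_rank, finrank_euclideanSpace_fin]; exact_mod_cast hn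
  have hconn : IsPreconnected ({0}ᶜ : Set (Coord n)) :=
    (isConnected_compl_singleton_of_one_lt_rank hrank 0).isPreconnected
  have hd : ∀ w ≠ 0, HasFDerivAt (fun w => φ (x, w)) (0 : Coord n →L[ℝ] ℝ) w := fun w hw => by
    have hz : (x, w) ∈ slitOver U := ⟨hx, hw⟩
    have h1 := (differentiableAt_of_contDiffOn (isOpen_slitOver hU) h.1 hz).hasFDerivAt
    have h2 := h1.comp w (hasFDerivAt_prodMk_right x w)
    have h3 : (fderiv ℝ φ (x, w)).comp (ContinuousLinearMap.inr ℝ (Coord n) (Coord n)) = 0 := by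
      ext v
      have := sum_mul_dy φ (x, w) v
      simp only [h.2 _ _ hz, mul_zero, Finset.sum_const_zero] at this
      simpa using this.symm
    rwa [h3] at h2
  exact isOpen_compl_singleton.is_const_of_fderiv_eq_zero hconn
    (fun w hw => (hd w hw).differentiableAt.differentiableWithinAt)
    (fun w hw => (hd w hw).fderiv) hy hy'

/-- A homogeneous fibrewise polynomial of degree `d` has the parity of `d`. -/
theorem FibrePoly.apply_neg (hn : 2 ≤ n) (hU : IsOpen U) {d : ℕ}
    (h : FibrePoly (slitOver U) d φ) (hh : IsEulerHom (slitOver U) d φ)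
    {x y : Coord n} (hx : x ∈ U) (hy : y ≠ 0) : φ (x, -y) = (-1) ^ d * φ (x, y) := by
  induction d generalizing φ with
  | zero => rw [h.eq_of_fst_eq hn hU hx (neg_ne_zero.2 hy) hy]; ring
  | succ d ih =>
    have h1 : ∀ i, dy i φ (x, -y) = (-1) ^ d * dy i φ (x, y) := fun i => by
      refine ih (h.2 i) ?_
      convert hh.dy (isOpen_slitOver hU) h.smooth i using 1
      push_cast; ring
    have e1 := hh (x, -y) ⟨hx, neg_ne_zero.2 hy⟩
    have e2 := hh (x, y) ⟨hx, hy⟩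
    simp only [euler, h1, PiLp.neg_apply, neg_mul, Finset.sum_neg_distrib,
      mul_left_comm _ ((-1 : ℝ) ^ d), ← Finset.mul_sum] at e1 e2
    rw [e2] at e1
    have hd : ((d + 1 : ℕ) : ℝ) ≠ 0 := by positivity
    refine mul_left_cancel₀ hd ?_
    rw [← e1, pow_succ]; ring

namespace IsRandersPair

variable {α β f : Coord n × Coord n → ℝ} {z : Coord n × Coord n}

theorem randersS_hom (h : IsRandersPair U α β f) (l : Fin n) :
    IsEulerHom (slitOver U) 1 (randersS β l) := by
  have hΩ := h.isOpen_slit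
  have hβ := h.beta_poly.smooth
  have h1 := (h.beta_hom.dy hΩ hβ l).alongDx hΩ (contDiffOn_dy hΩ hβ l)
  rw [sub_add_cancel] at h1
  exact (h1.sub hΩ (contDiffOn_alongDx hΩ (contDiffOn_dy hΩ hβ l)) (contDiffOn_dx hΩ hβ l)
    (h.beta_hom.dx hΩ hβ l)).const_mul hΩ
    ((contDiffOn_alongDx hΩ (contDiffOn_dy hΩ hβ l)).sub (contDiffOn_dx hΩ hβ l)) _

theorem randersSZero_hom (h : IsRandersPair U α β f) :
    IsEulerHom (slitOver U) 1 (randersSZero α β) := by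
  have hΩ := h.isOpen_slit
  have hβ := h.beta_poly.smooth
  have h0 : ∀ m l, IsEulerHom (slitOver U) 0 (fundInv α m l) := fun m l z hz => by
    simp [euler, (h.fundInv_poly m l).2 _ z hz]
  have h1 : ∀ m, IsEulerHom (slitOver U) 1 (randersSUp α β m) := fun m => by
    have := IsEulerHom.sum_mul hΩ (fun l => (h.fundInv_poly m l).smooth)
      (fun l => (h.randersS_poly l).smooth) (h0 m) h.randersS_hom
    rwa [zero_add] at this
  have := IsEulerHom.sum_mul hΩ (fun m => (h.randersSUp_poly m).smooth)
    (fun m => contDiffOn_dy hΩ hβ m) h1 (fun m => h.beta_hom.dy hΩ hβ m)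
  rwa [sub_self, add_zero] at this

theorem randersR_hom (h : IsRandersPair U α β f) :
    IsEulerHom (slitOver U) 2 (randersR α β) := by
  have hΩ := h.isOpen_slit
  have hβ := h.beta_poly.smooth
  have hγ := fun m => (h.spray_alpha_poly m).smooth
  have h1 := h.beta_hom.alongDx hΩ hβ
  have h2 := IsEulerHom.sum_mul hΩ hγ (fun m => contDiffOn_dy hΩ hβ m) h.finsler_alpha.spray_hom
    (fun m => h.beta_hom.dy hΩ hβ m)
  rw [sub_self, add_zero] at h2
  rw [one_add_one_eq_two] at h1
  exact h1.sub hΩ (contDiffOn_alongDx hΩ hβ) (contDiffOn_const.mul (contDiffOn_vert hΩ hγ hβ))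
    (h2.const_mul hΩ (contDiffOn_vert hΩ hγ hβ) 2)

theorem randersP_hom (h : IsRandersPair U α β f) :
    IsEulerHom (slitOver U) 1 (randersP α β f) := fun z hz => by
  have hΩ := h.isOpen_slit
  have hα := h.finsler_alpha.smooth
  have hs := h.randersSZero_poly.smooth
  have hr := h.randersR_poly.smooth
  have h1 := h.finsler_alpha.hom.mul hΩ hα hs h.randersSZero_hom
  rw [one_add_one_eq_two] at h1
  have h2 := (h.randersR_hom.const_mul hΩ hr (1 / 2)).sub hΩ (contDiffOn_const.mul hr)
    (hα.mul hs) h1 z hz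
  have h3 : euler (fun w => f w * randersP α β f w) z = 2 * (f z * randersP α β f z) := by
    rw [h.mul_randersP hz, ← h2]
    exact Finset.sum_congr rfl fun m _ => by rw [eqOn_dy hΩ (fun z hz => h.mul_randersP hz) m hz]
  rw [euler_mul hΩ h.finsler.smooth h.randersP_smooth hz, h.finsler.hom z hz] at h3
  exact mul_left_cancel₀ (h.pos z hz).ne' (by linarith)

theorem sum_mul_randersU (h : IsRandersPair U α β f) (hz : z ∈ slitOver U) :
    ∑ k, z.2 k * randersU α β f k z = 0 := by
  have h0 := (h.alpha_pos z hz).ne'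
  have h1 := h.randersP_hom z hz
  have h2 := h.finsler_alpha.hom z hz
  have h3 := h.sum_mul_randersS hz
  have h4 : ∑ k, z.2 k * randersU α β f k z = euler (randersP α β f) z
      - randersP α β f z / α z * euler α z + (∑ k, z.2 k * randersS β k z) / α z := by
    simp only [euler, Finset.mul_sum, Finset.sum_div, ← Finset.sum_sub_distrib,
      ← Finset.sum_add_distrib, randersU]
    exact Finset.sum_congr rfl fun _ _ => by ring
  rw [h4, h1, h2, h3]; field_simp; ring

theorem landsberg_symm (h : IsRandersPair U α β f) (hz : z ∈ slitOver U) (i j k : Fin n) :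
    landsberg f i j k z = landsberg f j i k z := by
  rw [h.landsberg_eq hz, h.landsberg_eq hz, dy_dy_comm h.isOpen_slit h.finsler_alpha.smooth hz i j]
  ring

theorem sum_mul_landsberg (h : IsRandersPair U α β f) (hz : z ∈ slitOver U) (i k : Fin n) :
    ∑ j, z.2 j * landsberg f i j k z = 0 := by
  have hΩ := h.isOpen_slit
  have hα := h.finsler_alpha.smooth
  have h1 : ∀ i, ∑ j, z.2 j * dy j (dy i α) z = 0 := fun i => by
    simpa [euler] using h.finsler_alpha.hom.dy hΩ hα i z hz
  have h2 : ∑ j, z.2 j * landsberg f i j k z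
      = (1 / 2) * f z * ((∑ j, z.2 j * dy j (dy i α) z) * randersU α β f k z
        + dy k (dy i α) z * (∑ j, z.2 j * randersU α β f j z)
        + (∑ j, z.2 j * dy j (dy k α) z) * randersU α β f i z) := by
    simp only [Finset.mul_sum, Finset.sum_mul, ← Finset.sum_add_distrib]
    refine Finset.sum_congr rfl fun j _ => ?_
    rw [h.landsberg_eq hz, dy_dy_comm hΩ hα hz k j]; ring
  rw [h2, h1, h1, h.sum_mul_randersU hz]; ring

open Matrix in
/-- If the matrices `L_ijk ξᵏ` of a Randers metric commute with respect to the fundamental tensor,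
then the obstruction `u` vanishes. -/
theorem randersU_eq_zero_of_commute (h : IsRandersPair U α β f) (hn : 3 ≤ n)
    (hz : z ∈ slitOver U)
    (hcomm : ∀ ξ η : Fin n → ℝ,
      (Matrix.of fun i j => ∑ k, landsberg f i j k z * ξ k)
        * ((fundMatrix f z)⁻¹ * Matrix.of fun i j => ∑ k, landsberg f i j k z * η k)
      = (Matrix.of fun i j => ∑ k, landsberg f i j k z * η k)
        * ((fundMatrix f z)⁻¹ * Matrix.of fun i j => ∑ k, landsberg f i j k z * ξ k))
    (k : Fin n) : randersU α β f k z = 0 := by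
  have hΩ := h.isOpen_slit
  -- The angular metric is `F α_ij = g_ij - F_i F_j`.
  have hh : ∀ i j, f z * dy j (dy i α) z = fundTensor f i j z - dy i f z * dy j f z := fun i j => by
    rw [fundTensor, h.finsler.dy_dy_energy_eq hz, ← h.dy_dy_eq hz,
      dy_dy_comm hΩ h.finsler.smooth hz j i]
    ring
  have hL : ∀ i j k, landsberg f i j k z = (1 / 2)
      * ((fundTensor f i j z - dy i f z * dy j f z) * randersU α β f k z
        + (fundTensor f i k z - dy i f z * dy k f z) * randersU α β f j z
        + (fundTensor f j k z - dy j f z * dy k f z) * randersU α β f i z) := fun i j k => by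
    rw [h.landsberg_eq hz, ← hh, ← hh, ← hh]; ring
  have hang : ∀ (η : Fin n → ℝ) i, (fundMatrix f z *ᵥ η) i - (fun l => dy l f z) ⬝ᵥ η * dy i f z
      = ∑ j, (fundTensor f i j z - dy i f z * dy j f z) * η j := fun η i => by
    simp only [fundMatrix, Matrix.mulVec, dotProduct, Matrix.of_apply, Finset.sum_mul, sub_mul,
      Finset.sum_sub_distrib]
    congr 1
    exact Finset.sum_congr rfl fun _ _ => by ring
  have hy : fundMatrix f z *ᵥ (fun i => z.2 i) = f z • (fun l => dy l f z) := by
    ext l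
    have h1 := h.finsler.dy_hom l z hz
    have h2 := h.finsler.vert_dy hz (fun m w => w.2 m) l
    change euler _ z = _ at h2
    rw [h1, one_mul, h.finsler.dy_energy_eq hz] at h2
    simp only [fundMatrix, Matrix.mulVec, dotProduct, Matrix.of_apply, Pi.smul_apply, smul_eq_mul]
    linarith
  have hu : (fun k => randersU α β f k z) ⬝ᵥ (fun i => z.2 i) = 0 := by
    rw [dotProduct_comm]; exact h.sum_mul_randersU hz
  have key := eq_zero_of_commute hn (h.finsler.posDef z hz) (h.pos z hz).ne' hy hu
    (M := fun ξ => Matrix.of fun i j => ∑ k, landsberg f i j k z * ξ k) ?_ ?_ hcomm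
  · exact congrFun key k
  · intro ξ η
    ext i
    simp only [Pi.smul_apply, Pi.add_apply, Pi.sub_apply, smul_eq_mul, hang]
    have h3 : η ⬝ᵥ (fundMatrix f z *ᵥ ξ - ((fun l => dy l f z) ⬝ᵥ ξ) • fun l => dy l f z)
        = ∑ j, η j * ∑ k, (fundTensor f j k z - dy j f z * dy k f z) * ξ k :=
      Finset.sum_congr rfl fun j _ => by
        rw [← hang]; simp only [Pi.smul_apply, Pi.sub_apply, smul_eq_mul]
    rw [h3]
    simp only [Matrix.mulVec, dotProduct, Matrix.of_apply, hL]
    rw [Finset.sum_mul_sum, Finset.sum_comm, Finset.sum_mul_sum]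
    simp only [Finset.mul_sum, Finset.sum_mul, ← Finset.sum_add_distrib]
    exact Finset.sum_congr rfl fun j _ => Finset.sum_congr rfl fun k _ => by ring
  · intro ξ
    ext i j
    simp only [Matrix.transpose_apply, Matrix.of_apply, h.landsberg_symm hz i j]

/-- If `u = 0` then the form `s` vanishes: the vertical derivative of `α P_k - P α_k = -s_k₀` gives
`s_jk = α_j P_k - α_k P_j`, which vanishes for `y` orthogonal to `∂_j` and `∂_k`, and `s_jk` does
not depend on `y`. -/
theorem randersS_eq_zero (h : IsRandersPair U α β f) (hn : 3 ≤ n)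
    (hu : ∀ z ∈ slitOver U, ∀ k, randersU α β f k z = 0) (hz : z ∈ slitOver U) (l : Fin n) :
    randersS β l z = 0 := by
  have hΩ := h.isOpen_slit
  have hα := h.finsler_alpha.smooth
  have hP := h.randersP_smooth
  have hα1 := contDiffOn_dy hΩ hα
  have hP1 := contDiffOn_dy hΩ hP
  have hrel : ∀ k, Set.EqOn (fun z => α z * dy k (randersP α β f) z - randersP α β f z * dy k α z)
      (fun z => (-1) * randersS β k z) (slitOver U) := fun k z hz => by
    have h0 := (h.alpha_pos z hz).ne'
    have h1 := hu z hz k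
    rw [randersU] at h1
    field_simp at h1
    linarith
  have hrel' : ∀ z ∈ slitOver U, ∀ j k, dy j (randersS β k) z
      = dy j (randersP α β f) z * dy k α z + randersP α β f z * dy j (dy k α) z
        - dy j α z * dy k (randersP α β f) z - α z * dy j (dy k (randersP α β f)) z :=
    fun z hz j k => by
      have h1 := eqOn_dy hΩ (hrel k) j hz
      rw [dy_sub hΩ (hα.mul (hP1 k)) (hP.mul (hα1 k)) hz, dy_mul hΩ hα (hP1 k) hz,
        dy_mul hΩ hP (hα1 k) hz, dy_const_mul hΩ (h.randersS_poly k).smooth hz] at h1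
      linarith
  have hs : ∀ z ∈ slitOver U, ∀ j k, dy j (randersS β k) z
      = dy j (randersP α β f) z * dy k α z - dy j α z * dy k (randersP α β f) z :=
    fun z hz j k => by
      have h1 := hrel' z hz j k
      have h2 := hrel' z hz k j
      rw [h.dy_randersS hz] at h1 h2
      rw [h.dy_randersS hz]
      rw [dy_dy_comm hΩ hα hz k j, dy_dy_comm hΩ hP hz k j] at h2
      linarith
  have hzero : ∀ j k, dy j (randersS β k) z = 0 := fun j k => by
    obtain ⟨v, hv0, hvj, hvk⟩ := exists_ne_zero_dotProduct_eq_zero hn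
      (fun m => fundTensor α j m z) (fun m => fundTensor α k m z)
    set y : Coord n := WithLp.toLp 2 v with hy
    have hy0 : y ≠ 0 := fun h0 => hv0 (by simpa [hy] using h0)
    have hw : (z.1, y) ∈ slitOver U := ⟨hz.1, hy0⟩
    have hpoly : ∀ i, (∑ m, fundTensor α i m z * v m = 0) → dy i α (z.1, y) = 0 := fun i hi => by
      have h1 := h.finsler_alpha.vert_dy hw (fun m w => w.2 m) i
      change euler _ _ = _ at h1
      rw [h.finsler_alpha.dy_hom i _ hw, h.finsler_alpha.dy_energy_eq hw] at h1
      have h2 : ∀ m, fundTensor α i m (z.1, y) = fundTensor α i m z := fun m =>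
        (h.fundTensor_poly i m).eq_of_fst_eq (by omega) h.finsler.isOpen hz.1 hy0 hz.2
      simp only [h2] at h1
      change _ = 2 * ∑ m, fundTensor α i m z * v m at h1
      rw [hi] at h1
      simpa [(h.alpha_pos _ hw).ne'] using h1
    have h3 : dy j (randersS β k) (z.1, y) = 0 := by
      rw [hs _ hw, hpoly j hvj, hpoly k hvk]; ring
    rw [← h3]
    exact ((h.randersS_poly k).2 j).eq_of_fst_eq (by omega) h.finsler.isOpen hz.1 hz.2 hy0
  have := h.randersS_hom l z hz
  simpa [euler, hzero] using this.symm

/-- A Randers metric with `u = 0` is a Berwald metric. -/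
theorem berwald_eq_zero (h : IsRandersPair U α β f) (hn : 3 ≤ n)
    (hu : ∀ z ∈ slitOver U, ∀ k, randersU α β f k z = 0) (hz : z ∈ slitOver U)
    (i j k l : Fin n) : berwaldCurv f i j k l z = 0 := by
  have hΩ := h.isOpen_slit
  have hα := h.finsler_alpha.smooth
  have hP := h.randersP_smooth
  have hU := h.finsler.isOpen
  have hS : ∀ z ∈ slitOver U, ∀ m, randersSUp α β m z = 0 := fun z hz m =>
    Finset.sum_eq_zero fun l _ => by rw [h.randersS_eq_zero hn hu hz, mul_zero]
  have hPr : ∀ z ∈ slitOver U, f z * randersP α β f z = (1 / 2) * randersR α β z := fun z hz => by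
    have h0 : randersSZero α β z = 0 := by simp [randersSZero, vert, hS z hz]
    rw [h.mul_randersP hz, h0]; ring
  -- `P / α` is constant along the fibres.
  have hφ : FibrePoly (slitOver U) 0 (fun z => randersP α β f z * (α z)⁻¹) := by
    have hinv : ContDiffOn ℝ ∞ (fun z => randersP α β f z * (α z)⁻¹) (slitOver U) :=
      hP.mul (hα.inv fun z hz => (h.alpha_pos z hz).ne')
    refine ⟨hinv, fun k z hz => ?_⟩
    have h0 := (h.alpha_pos z hz).ne'
    have h1 : Set.EqOn (fun z => randersP α β f z * (α z)⁻¹ * α z) (randersP α β f)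
        (slitOver U) := fun z hz => by
      have := (h.alpha_pos z hz).ne'
      simp only; field_simp
    have h2 := eqOn_dy hΩ h1 k hz
    rw [dy_mul hΩ hinv hα hz] at h2
    have h3 := hu z hz k
    rw [randersU, h.randersS_eq_zero hn hu hz] at h3
    refine mul_right_cancel₀ h0 ?_
    rw [zero_mul, ← h3, ← h2]
    field_simp
    ring
  -- `P` and `α` are even in `y`, as is `r₀₀ = 2 (α + β) P`, but `β` is odd.
  have hβP : ∀ z ∈ slitOver U, β z * randersP α β f z = 0 := fun z hz => by
    have hn2 : 2 ≤ n := by omega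
    have hz' : (z.1, -z.2) ∈ slitOver U := ⟨hz.1, neg_ne_zero.2 hz.2⟩
    have h0 := h.alpha_pos z hz
    have h0' := h.alpha_pos _ hz'
    have e1 : α (z.1, -z.2) = α z := by
      have := h.energy_poly.apply_neg hn2 hU (by exact_mod_cast h.finsler_alpha.energy_hom)
        hz.1 hz.2
      simp only [energy, even_two.neg_pow, one_pow, one_mul] at this
      exact (pow_left_inj₀ h0'.le h0.le two_ne_zero).1 this
    have e2 : β (z.1, -z.2) = -β z := by
      simpa using h.beta_poly.apply_neg hn2 hU (by exact_mod_cast h.beta_hom) hz.1 hz.2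
    have e3 : randersR α β (z.1, -z.2) = randersR α β z := by
      simpa using h.randersR_poly.apply_neg hn2 hU (by exact_mod_cast h.randersR_hom) hz.1 hz.2
    have e4 : randersP α β f (z.1, -z.2) = randersP α β f z := by
      have := hφ.eq_of_fst_eq hn2 hU hz.1 hz'.2 hz.2
      simp only [e1] at this
      exact mul_right_cancel₀ (inv_ne_zero h0.ne') this
    have e5 := hPr z hz
    have e6 := hPr _ hz'
    have e7 : f (z.1, -z.2) = α (z.1, -z.2) + β (z.1, -z.2) := h.eqOn hz'
    have e8 : f z = α z + β z := h.eqOn hz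
    rw [e3, e4, e7, e1, e2] at e6
    rw [e8] at e5
    linarith
  -- Where `P ≠ 0`, `β` vanishes in a neighbourhood, hence so do `r₀₀` and `P`.
  have hP0 : ∀ z ∈ slitOver U, randersP α β f z = 0 := fun z hz => by
    by_contra hne
    have hev : β =ᶠ[nhds z] fun _ => 0 := by
      filter_upwards [hΩ.mem_nhds hz,
        (hP.continuousOn.continuousAt (hΩ.mem_nhds hz)).eventually_ne hne] with w hw hw0
      exact (mul_eq_zero.1 (hβP w hw)).resolve_right hw0
    have hfd : fderiv ℝ β z = 0 := by rw [hev.fderiv_eq]; simp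
    have hr : randersR α β z = 0 := by
      simp [randersR, alongDx, vert, dx, dy, hfd]
    have := hPr z hz
    rw [hr, mul_zero] at this
    exact hne ((mul_eq_zero.1 this).resolve_left (h.pos z hz).ne')
  have hG : Set.EqOn (sprayCoeff f i) (sprayCoeff α i) (slitOver U) := fun z hz => by
    rw [h.spray_eq hz, hP0 z hz, hS z hz]; ring
  rw [berwaldCurv, eqOn_dy hΩ (eqOn_dy hΩ (eqOn_dy hΩ hG j) k) l hz]
  exact (h.spray_alpha_poly i).dy_dy_dy_eq_zero hz j k l

end IsRandersPair

end RandersLandsberg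

/-! ### Coordinate expressions of Randers metrics -/

section Coefficients

variable {n : ℕ} {U : Set (Coord n)} {z : Coord n × Coord n}

/-- `b_i(x) yⁱ`. -/
def linearForm (b : Fin n → Coord n → ℝ) (z : Coord n × Coord n) : ℝ := ∑ i, b i z.1 * z.2 i

/-- `a_ij(x) yⁱ yʲ`. -/
def quadForm (a : Fin n → Fin n → Coord n → ℝ) (z : Coord n × Coord n) : ℝ :=
  ∑ i, z.2 i * linearForm (a i) z

theorem linearForm_poly (hU : IsOpen U) {b : Fin n → Coord n → ℝ}
    (hb : ∀ i, ContDiffOn ℝ ∞ (b i) U) : FibrePoly (slitOver U) 1 (linearForm b) :=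
  FibrePoly.sum (isOpen_slitOver hU) fun i =>
    (FibrePoly.comp_fst hU (hb i)).mul (isOpen_slitOver hU) (FibrePoly.snd_apply i) rfl

theorem quadForm_poly (hU : IsOpen U) {a : Fin n → Fin n → Coord n → ℝ}
    (ha : ∀ i j, ContDiffOn ℝ ∞ (a i j) U) : FibrePoly (slitOver U) 2 (quadForm a) :=
  FibrePoly.sum (isOpen_slitOver hU) fun i =>
    (FibrePoly.snd_apply i).mul (isOpen_slitOver hU) (linearForm_poly hU (ha i)) rfl

theorem dy_linearForm (hU : IsOpen U) {b : Fin n → Coord n → ℝ}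
    (hb : ∀ i, ContDiffOn ℝ ∞ (b i) U) (hz : z ∈ slitOver U) (k : Fin n) :
    dy k (linearForm b) z = b k z.1 := by
  have hΩ := isOpen_slitOver hU
  have h1 : dy k (linearForm b) z = _ :=
    dy_sum_mul hΩ (fun i => (FibrePoly.comp_fst hU (hb i)).smooth) contDiffOn_snd_apply hz k
  simp [h1, dy_snd_apply, (FibrePoly.comp_fst hU (hb _)).2 k z hz]

theorem dy_quadForm (hU : IsOpen U) {a : Fin n → Fin n → Coord n → ℝ}
    (ha : ∀ i j, ContDiffOn ℝ ∞ (a i j) U) (hz : z ∈ slitOver U) (k : Fin n) :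
    dy k (quadForm a) z = linearForm (a k) z + ∑ i, z.2 i * a i k z.1 := by
  have hΩ := isOpen_slitOver hU
  have h1 : dy k (quadForm a) z = _ :=
    dy_sum_mul hΩ contDiffOn_snd_apply (fun i => (linearForm_poly hU (ha i)).smooth) hz k
  simp [h1, dy_snd_apply, dy_linearForm hU (ha _) hz]

theorem quadForm_smul (a : Fin n → Fin n → Coord n → ℝ) (z : Coord n × Coord n) (c : ℝ) :
    quadForm a (z.1, c • z.2) = c ^ 2 * quadForm a z := by
  simp only [quadForm, linearForm, PiLp.smul_apply, smul_eq_mul, Finset.mul_sum]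
  exact Finset.sum_congr rfl fun _ _ => Finset.sum_congr rfl fun _ _ => by ring

theorem linearForm_smul (b : Fin n → Coord n → ℝ) (z : Coord n × Coord n) (c : ℝ) :
    linearForm b (z.1, c • z.2) = c * linearForm b z := by
  simp only [linearForm, PiLp.smul_apply, smul_eq_mul, Finset.mul_sum]
  exact Finset.sum_congr rfl fun _ _ => by ring

/-- Smooth coefficients `a_ij(x)`, positive definite, define a Finsler metric `√(a_ij yⁱ yʲ)`, with
fundamental tensor `a_ij`. -/
theorem isLocalFinsler_sqrt_quadForm (hU : IsOpen U) {a : Fin n → Fin n → Coord n → ℝ}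
    (ha : ∀ i j, ContDiffOn ℝ ∞ (a i j) U) (hsymm : ∀ x ∈ U, ∀ i j, a i j x = a j i x)
    (hpos : ∀ z : Coord n × Coord n, z ∈ slitOver U → 0 < quadForm a z) :
    IsLocalFinsler U (fun z => √(quadForm a z)) := by
  have hΩ := isOpen_slitOver hU
  have hsm : ContDiffOn ℝ ∞ (fun z => √(quadForm a z)) (slitOver U) :=
    (quadForm_poly hU ha).smooth.sqrt fun z hz => (hpos z hz).ne'
  refine ⟨hU, hsm, isEulerHom_one hU hsm fun z _ c hc => ?_, fun z hz => ?_⟩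
  · rw [quadForm_smul, Real.sqrt_mul (sq_nonneg c), Real.sqrt_sq hc.le]
  · have hE : Set.EqOn (energy fun z => √(quadForm a z)) (quadForm a) (slitOver U) :=
      fun z hz => Real.sq_sqrt (hpos z hz).le
    have hfund : ∀ i j, fundTensor (fun z => √(quadForm a z)) i j z = a i j z.1 := fun i j => by
      have h1 : Set.EqOn (dy j (energy fun z => √(quadForm a z)))
          (fun z => 2 * linearForm (a j) z) (slitOver U) := fun z hz => by
        rw [eqOn_dy hΩ hE j hz, dy_quadForm hU ha hz]
        change _ = 2 * linearForm (a j) z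
        rw [two_mul]
        congr 1
        exact Finset.sum_congr rfl fun i _ => by rw [hsymm z.1 hz.1 i j, mul_comm]
      rw [fundTensor, eqOn_dy hΩ h1 i hz, dy_const_mul hΩ (linearForm_poly hU (ha j)).smooth hz,
        dy_linearForm hU (ha j) hz, hsymm z.1 hz.1 i j]
      ring
    have hM : fundMatrix (fun z => √(quadForm a z)) z = Matrix.of fun i j => a i j z.1 := by
      ext i j; exact hfund i j
    rw [hM]
    refine Matrix.PosDef.of_dotProduct_mulVec_pos ?_ fun v hv => ?_
    · ext i j
      simp [hsymm z.1 hz.1 i j]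
    · have := hpos (z.1, WithLp.toLp 2 v) ⟨hz.1, fun h0 => hv (by simpa using h0)⟩
      simpa [quadForm, linearForm, dotProduct, Matrix.mulVec] using this

/-- A positive Randers metric given by smooth coefficients `a_ij(x)` and `b_i(x)`. -/
theorem isRandersPair_of_coeff (hU : IsOpen U) {a : Fin n → Fin n → Coord n → ℝ}
    {b : Fin n → Coord n → ℝ} {f : Coord n × Coord n → ℝ}
    (ha : ∀ i j, ContDiffOn ℝ ∞ (a i j) U) (hb : ∀ i, ContDiffOn ℝ ∞ (b i) U)
    (hsymm : ∀ x ∈ U, ∀ i j, a i j x = a j i x)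
    (hpos : ∀ z : Coord n × Coord n, z ∈ slitOver U → 0 < quadForm a z)
    (hf : ∀ z ∈ slitOver U, f z = √(quadForm a z) + linearForm b z)
    (hnonneg : ∀ z ∈ slitOver U, 0 ≤ f z)
    (hposDef : ∀ z ∈ slitOver U, (fundMatrix f z).PosDef) :
    IsRandersPair U (fun z => √(quadForm a z)) (linearForm b) f := by
  have hΩ := isOpen_slitOver hU
  have hα := isLocalFinsler_sqrt_quadForm hU ha hsymm hpos
  have hβ := linearForm_poly hU hb
  have hfsm : ContDiffOn ℝ ∞ f (slitOver U) := (hα.smooth.add hβ.smooth).congr hf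
  have hfin : IsLocalFinsler U f := by
    refine ⟨hU, hfsm, isEulerHom_one hU hfsm fun z hz c hc => ?_, hposDef⟩
    rw [hf z hz, hf (z.1, c • z.2) ⟨hz.1, smul_ne_zero hc.ne' hz.2⟩, quadForm_smul,
      linearForm_smul, Real.sqrt_mul (sq_nonneg c), Real.sqrt_sq hc.le]
    ring
  refine ⟨hα, hfin, fun z hz => Real.sqrt_pos.2 (hpos z hz), fun z hz => ?_, ?_, hβ, ?_, hf⟩
  · -- If `F` vanished at `y` then so would `g_lm yᵐ = F F_l`.
    refine (hnonneg z hz).lt_of_ne fun h0 => hz.2 ?_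
    ext i
    rw [← hfin.sum_fundInv_mul hz (fun m => z.2 m)]
    refine Finset.sum_eq_zero fun l _ => ?_
    have h1 := hfin.vert_dy hz (fun m w => w.2 m) l
    change euler _ z = _ at h1
    rw [hfin.dy_hom l z hz, hfin.dy_energy_eq hz, ← h0] at h1
    have h2 : ∑ m, fundTensor f l m z * z.2 m = 0 := by linarith
    rw [h2, mul_zero]
  · exact (quadForm_poly hU ha).congr hΩ fun z hz => Real.sq_sqrt (hpos z hz).le
  · exact isEulerHom_one hU hβ.smooth fun z _ c _ => linearForm_smul b z c

end Coefficients

section Charts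

variable {n : ℕ} {M : Type*} [TopologicalSpace M] [ChartedSpace (Coord n) M]
  {e : OpenPartialHomeomorph M (Coord n)}

theorem mdifferentiable_of_mem_charts (he : e ∈ charts n M) : e.MDifferentiable (𝓡 n) (𝓡 n) :=
  ⟨(contMDiffOn_of_mem_maximalAtlas he).mdifferentiableOn (by simp),
    (contMDiffOn_symm_of_mem_maximalAtlas he).mdifferentiableOn (by simp)⟩

theorem coordVec_eq (he : e ∈ charts n M) {x : Coord n} (hx : x ∈ e.target) (v : Coord n) :
    coordVec e (e.symm x) v = mfderiv (𝓡 n) (𝓡 n) e.symm x v := by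
  have hd := mdifferentiable_of_mem_charts he
  have hs := e.map_target hx
  have h1 : (mfderiv (𝓡 n) 𝓘(ℝ, Coord n) e (e.symm x)).inverse
      = (hd.mfderiv hs).symm.toContinuousLinearMap :=
    ContinuousLinearMap.inverse_equiv (hd.mfderiv hs)
  have h2 : mfderiv (𝓡 n) 𝓘(ℝ, Coord n) e (e.symm x) (coordVec e (e.symm x) v) = v := by
    rw [coordVec, h1]; exact (hd.mfderiv hs).apply_symm_apply v
  have h3 := hd.comp_symm_deriv hx
  have h4 : mfderiv (𝓡 n) 𝓘(ℝ, Coord n) e (e.symm x) (mfderiv (𝓡 n) (𝓡 n) e.symm x v) = v :=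
    congrArg (fun L : Coord n →L[ℝ] Coord n => L v) h3
  exact hd.mfderiv_injective hs (h2.trans h4.symm)

theorem coordVec_ne_zero (he : e ∈ charts n M) {x : Coord n} (hx : x ∈ e.target) {v : Coord n}
    (hv : v ≠ 0) : coordVec e (e.symm x) v ≠ 0 := fun h => by
  rw [coordVec_eq he hx] at h
  exact hv ((mdifferentiable_of_mem_charts he).symm.mfderiv_injective (x := x) hx
    (h.trans (map_zero _).symm))

theorem coordVec_eq_sum (e : OpenPartialHomeomorph M (Coord n)) (p : M) (v : Coord n) :
    coordVec e p v = ∑ i, v i • coordVec e p (basisVec i) := by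
  have hv : v = ∑ i, v i • (basisVec i : Coord n) := by
    ext i; simp [Pi.single_apply]
  let L : Coord n →L[ℝ] Coord n := (mfderiv (𝓡 n) 𝓘(ℝ, Coord n) e p).inverse
  have hL : L (∑ i, v i • (basisVec i : Coord n)) = ∑ i, v i • L (basisVec i) := by
    simp only [map_sum, map_smul]
  exact (congrArg L hv).trans hL

variable [IsManifold (𝓡 n) ∞ M]

theorem contMDiffOn_coordVec (he : e ∈ charts n M) (v : Coord n) :
    ContMDiffOn (𝓡 n) (𝓡 n).tangent ∞
      (fun x => (⟨e.symm x, coordVec e (e.symm x) v⟩ : TangentBundle (𝓡 n) M)) e.target := by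
  have h1 := (contMDiffOn_symm_of_mem_maximalAtlas he).contMDiffOn_tangentMapWithin (m := ∞)
    (by simp) e.open_target.uniqueMDiffOn
  have h2 := (contMDiff_vectorSpace_iff_contDiff (𝕜 := ℝ) (n := ∞)
    (V := fun _ : Coord n => v)).2 contDiff_const
  refine (h1.comp h2.contMDiffOn fun x hx => hx).congr fun x hx => ?_
  simp only [Function.comp, tangentMapWithin]
  rw [mfderivWithin_of_isOpen e.open_target hx, coordVec_eq he hx]

theorem contDiffOn_inner_coordVec
    (a : Bundle.ContMDiffRiemannianMetric (𝓡 n) ∞ (Coord n) (fun p : M => TangentSpace (𝓡 n) p))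
    (he : e ∈ charts n M) (v w : Coord n) :
    ContDiffOn ℝ ∞ (fun x => a.inner (e.symm x) (coordVec e (e.symm x) v)
      (coordVec e (e.symm x) w)) e.target := by
  let _ : Bundle.RiemannianBundle (fun p : M => TangentSpace (𝓡 n) p) := ⟨a.toRiemannianMetric⟩
  exact ContMDiffOn.contDiffOn (ContMDiffOn.inner_bundle (contMDiffOn_coordVec he v)
    (contMDiffOn_coordVec he w))

theorem IsRanders.exists_isRandersPair {F : TangentBundle (𝓡 n) M → ℝ} (hF : IsRanders F)
    (he : e ∈ charts n M) : ∃ α β, IsRandersPair e.target α β (inChart F e) := by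
  obtain ⟨hfin, a, β, hβ, hFeq⟩ := hF
  have hb : ∀ i, ContDiffOn ℝ ∞
      (fun x => β (e.symm x) (coordVec e (e.symm x) (basisVec i))) e.target := fun i =>
    ContMDiffOn.contDiffOn (hβ.comp_contMDiffOn (contMDiffOn_coordVec he (basisVec i)))
  have hq : ∀ z : Coord n × Coord n, quadForm (fun i j x => a.inner (e.symm x)
      (coordVec e (e.symm x) (basisVec i)) (coordVec e (e.symm x) (basisVec j))) z
      = a.inner (e.symm z.1) (coordVec e (e.symm z.1) z.2) (coordVec e (e.symm z.1) z.2) := by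
    intro z
    conv_rhs => rw [coordVec_eq_sum e _ z.2]
    simp only [map_sum, map_smul, sum_apply, smul_apply, smul_eq_mul,
      quadForm, linearForm, Finset.mul_sum]
    refine Finset.sum_comm.trans ?_
    exact Finset.sum_congr rfl fun i _ => Finset.sum_congr rfl fun j _ => by ring
  have hl : ∀ z : Coord n × Coord n,
      linearForm (fun i x => β (e.symm x) (coordVec e (e.symm x) (basisVec i))) z
      = β (e.symm z.1) (coordVec e (e.symm z.1) z.2) := by
    intro z
    conv_rhs => rw [coordVec_eq_sum e _ z.2]
    simp only [map_sum, map_smul, smul_eq_mul, linearForm]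
    exact Finset.sum_congr rfl fun i _ => mul_comm _ _
  refine ⟨_, _, isRandersPair_of_coeff e.open_target
    (fun i j => contDiffOn_inner_coordVec a he (basisVec i) (basisVec j)) hb
    (fun x _ i j => a.symm _ _ _) (fun z hz => ?_) (fun z hz => ?_) (fun z _ => hfin.nonneg _)
    (fun z hz => hfin.posDef e he z hz)⟩
  · rw [hq]
    exact a.pos _ _ (coordVec_ne_zero he hz.1 hz.2)
  · rw [hq, hl]
    exact hFeq _

end Charts

/-! ### The change of curvature under the `L`-process -/

section CurvatureChange

variable {n : ℕ} {M : Type*} [TopologicalSpace M] [ChartedSpace (Coord n) M]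
  [IsManifold (𝓡 n) ∞ M] {F : TangentBundle (𝓡 n) M → ℝ} {D D' : PullConnection n M}
  {e : OpenPartialHomeomorph M (Coord n)} {z : Coord n × Coord n}

/-- The `1`-forms `Lⁱ_jk dxᵏ` as a matrix with row index `i` and column index `j`, evaluated on a
vector with horizontal components `ξ`. -/
def landsbergForm (f : Coord n × Coord n → ℝ) (ξ : Coord n) (z : Coord n × Coord n) :
    Matrix (Fin n) (Fin n) ℝ := Matrix.of fun i j => ∑ k, landsbergUp f i j k z * ξ k

theorem IsLocalFinsler.landsbergForm_smooth {U : Set (Coord n)} {f : Coord n × Coord n → ℝ}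
    (hf : IsLocalFinsler U f) (ξ : Coord n) (i j : Fin n) :
    ContDiffOn ℝ ∞ (fun w => landsbergForm f ξ w i j) (slitOver U) := by
  simp only [landsbergForm, Matrix.of_apply]
  exact ContDiffOn.sum fun k _ => (hf.landsbergUp_smooth i j k).mul contDiffOn_const

/-- Lowering an index in `Lⁱ_jk ξᵏ`. -/
theorem IsLocalFinsler.fundMatrix_mul_landsbergForm {U : Set (Coord n)}
    {f : Coord n × Coord n → ℝ} (hf : IsLocalFinsler U f) (hz : z ∈ slitOver U) (ξ : Coord n) :
    fundMatrix f z * landsbergForm f ξ z = Matrix.of fun i j => ∑ k, landsberg f i j k z * ξ k := by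
  ext i j
  simp only [Matrix.mul_apply, landsbergForm, Matrix.of_apply, fundMatrix, Finset.mul_sum]
  rw [Finset.sum_comm]
  refine Finset.sum_congr rfl fun k _ => ?_
  rw [← hf.sum_fundTensor_mul hz (fun l => landsberg f l j k z) i, Finset.sum_mul]
  simp only [landsbergUp, mul_assoc]

theorem IsRandersPair.landsbergForm_symm {U : Set (Coord n)} {α β f : Coord n × Coord n → ℝ}
    (h : IsRandersPair U α β f) (hz : z ∈ slitOver U) (ξ : Coord n) :
    (fundMatrix f z * landsbergForm f ξ z).transpose = fundMatrix f z * landsbergForm f ξ z := by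
  rw [h.finsler.fundMatrix_mul_landsbergForm hz]
  ext i j
  simp only [Matrix.transpose_apply, Matrix.of_apply, h.landsberg_symm hz i j]

theorem IsRandersPair.sum_mul_landsbergForm {U : Set (Coord n)} {α β f : Coord n × Coord n → ℝ}
    (h : IsRandersPair U α β f) (hz : z ∈ slitOver U) (ξ : Coord n) (i : Fin n) :
    ∑ j, z.2 j * landsbergForm f ξ z i j = 0 := by
  have h1 : ∀ k, ∑ j, z.2 j * landsbergUp f i j k z = 0 := fun k => by
    simp only [landsbergUp, Finset.mul_sum]
    rw [Finset.sum_comm]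
    refine Finset.sum_eq_zero fun l _ => ?_
    simp only [mul_left_comm _ (fundInv f i l z), ← Finset.mul_sum, h.sum_mul_landsberg hz,
      mul_zero]
  simp only [landsbergForm, Matrix.of_apply, Finset.mul_sum]
  rw [Finset.sum_comm]
  refine Finset.sum_eq_zero fun k _ => ?_
  simp only [← mul_assoc, ← Finset.sum_mul, h1, zero_mul]

namespace PullConnection

/-- The `L`-process does not change the horizontal distribution, since `Lⁱ_jk yʲ = 0`. -/
theorem IsMatsumotoL.isHorizontal_iff (hL : D.IsMatsumotoL D' F) (he : e ∈ charts n M)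
    {α β : Coord n × Coord n → ℝ} (h : IsRandersPair e.target α β (inChart F e))
    (hz : z ∈ natDomain e) (X : Coord n × Coord n) :
    D'.IsHorizontal e z X ↔ D.IsHorizontal e z X := by
  have hmu : ∀ i, D'.mu e i z X = D.mu e i z X := fun i => by
    have h1 := h.sum_mul_landsbergForm hz X.1 i
    simp only [landsbergForm, Matrix.of_apply] at h1
    simp only [mu, hL e he z hz, mul_add, Finset.sum_add_distrib, h1, add_zero]
  simp only [IsHorizontal, hmu]

/-- The change of the curvature forms under the `L`-process. -/
theorem IsMatsumotoL.curvature_sub (hL : D.IsMatsumotoL D' F) (he : e ∈ charts n M)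
    (h : IsLocalFinsler e.target (inChart F e)) (hz : z ∈ natDomain e) (X Y : Coord n × Coord n)
    (i j : Fin n) :
    D'.curvature e j i z X Y - D.curvature e j i z X Y
      = fderiv ℝ (fun w => landsbergForm (inChart F e) Y.1 w i j) z X
        - fderiv ℝ (fun w => landsbergForm (inChart F e) X.1 w i j) z Y
        - ∑ k, (D.form e k i z Y * landsbergForm (inChart F e) X.1 z k j
          + landsbergForm (inChart F e) Y.1 z i k * D.form e j k z X
          + landsbergForm (inChart F e) Y.1 z i k * landsbergForm (inChart F e) X.1 z k j
          - D.form e k i z X * landsbergForm (inChart F e) Y.1 z k j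
          - landsbergForm (inChart F e) X.1 z i k * D.form e j k z Y
          - landsbergForm (inChart F e) X.1 z i k * landsbergForm (inChart F e) Y.1 z k j) := by
  have hΩ := h.isOpen_slit
  have hform : ∀ i j X, Set.EqOn (fun w => D'.form e j i w X)
      (fun w => D.form e j i w X + landsbergForm (inChart F e) X.1 w i j) (slitOver e.target) :=
    fun i j X w hw => hL e he w hw X i j
  have hd : ∀ V W, fderiv ℝ (fun w => D'.form e j i w V) z W
      = fderiv ℝ (fun w => D.form e j i w V) z W
        + fderiv ℝ (fun w => landsbergForm (inChart F e) V.1 w i j) z W := fun V W => by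
    rw [fderiv_congr_of_eqOn hΩ (hform i j V) hz]
    exact congrArg (· W) (fderiv_fun_add
      (differentiableAt_of_contDiffOn hΩ (D.smooth e he j i V) hz)
      (differentiableAt_of_contDiffOn hΩ (h.landsbergForm_smooth V.1 i j) hz))
  have hv : ∀ i j V, D'.form e j i z V
      = D.form e j i z V + landsbergForm (inChart F e) V.1 z i j := fun i j V => hform i j V hz
  rw [curvature, curvature, hd, hd]
  simp only [hv]
  have : ∀ a b c d s t u : ℝ, (a + b - (c + d) - s) - (a - c - t) = b - d - (s - t) := by
    intros; ring
  rw [this _ _ _ _ _ _ 0, ← Finset.sum_sub_distrib]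
  congr 1
  exact Finset.sum_congr rfl fun k _ => by ring

open Matrix in
/-- If the curvatures agree on the horizontal vectors `X`, `Y`, then the matrices `L_ijk Xᵏ` and
`L_ijk Yᵏ` commute with respect to the fundamental tensor. -/
theorem IsMatsumotoL.landsbergForm_comm (hL : D.IsMatsumotoL D' F) (hmet : D.HMetrical F)
    (he : e ∈ charts n M) {α β : Coord n × Coord n → ℝ}
    (h : IsRandersPair e.target α β (inChart F e)) (hz : z ∈ natDomain e)
    {X Y : Coord n × Coord n} (hX : D.IsHorizontal e z X) (hY : D.IsHorizontal e z Y)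
    (heq : ∀ i j, D'.curvature e j i z X Y = D.curvature e j i z X Y) :
    fundMatrix (inChart F e) z * landsbergForm (inChart F e) X.1 z
        * landsbergForm (inChart F e) Y.1 z
      = fundMatrix (inChart F e) z * landsbergForm (inChart F e) Y.1 z
        * landsbergForm (inChart F e) X.1 z := by
  set f := inChart F e with hf
  have hΩ := h.isOpen_slit
  -- The derivative of the symmetric matrix `L_ijk ξᵏ` along a horizontal vector, with `g` parallel.
  have hS : ∀ V (ξ : Coord n), D.IsHorizontal e z V →
      (((Matrix.of fun i j => D.form e j i z V)ᵀ * fundMatrix f z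
          + fundMatrix f z * Matrix.of fun i j => D.form e j i z V) * landsbergForm f ξ z
        + fundMatrix f z * Matrix.of fun i j => fderiv ℝ (fun w => landsbergForm f ξ w i j) z V)
      = Matrix.of fun i j =>
        fderiv ℝ (fun w => (fundMatrix f w * landsbergForm f ξ w) i j) z V := by
    intro V ξ hV
    have hg : ∀ i m, fderiv ℝ (fundTensor f i m) z V
        = ((Matrix.of fun i j => D.form e j i z V)ᵀ * fundMatrix f z
          + fundMatrix f z * Matrix.of fun i j => D.form e j i z V) i m := fun i m => by
      have h1 := hmet e he z hz V hV i m
      rw [sub_eq_zero.1 h1]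
      simp only [Matrix.add_apply, Matrix.mul_apply, Matrix.transpose_apply, Matrix.of_apply,
        fundMatrix, Finset.sum_add_distrib]
      congr 1
      exact Finset.sum_congr rfl fun _ _ => mul_comm _ _
    ext i j
    simp only [Matrix.of_apply, Matrix.mul_apply (M := fundMatrix f _)]
    have h2 := fderiv_sum_mul_apply hΩ (fun m => h.finsler.fundTensor_smooth i m)
      (fun m => h.finsler.landsbergForm_smooth ξ m j) hz V
    simp only [hg] at h2
    refine Eq.trans ?_ h2.symm
    rw [Matrix.add_apply, Matrix.mul_apply, Matrix.mul_apply]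
    rfl
  have hSt : ∀ V (ξ : Coord n), (Matrix.of fun i j =>
      fderiv ℝ (fun w => (fundMatrix f w * landsbergForm f ξ w) i j) z V)ᵀ = Matrix.of fun i j =>
      fderiv ℝ (fun w => (fundMatrix f w * landsbergForm f ξ w) i j) z V := fun V ξ => by
    ext i j
    have h1 : Set.EqOn (fun w => (fundMatrix f w * landsbergForm f ξ w) j i)
        (fun w => (fundMatrix f w * landsbergForm f ξ w) i j) (slitOver e.target) :=
      fun w hw => congrFun (congrFun (h.landsbergForm_symm hw ξ) i) j
    exact congrArg (· V) (fderiv_congr_of_eqOn hΩ h1 hz)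
  refine mul_comm_of_curvature_eq (g := fundMatrix f z)
    (A := Matrix.of fun i j => D.form e j i z X) (B := Matrix.of fun i j => D.form e j i z Y)
    (dX := Matrix.of fun i j => fderiv ℝ (fun w => landsbergForm f Y.1 w i j) z X)
    (dY := Matrix.of fun i j => fderiv ℝ (fun w => landsbergForm f X.1 w i j) z Y)
    ?_ (h.landsbergForm_symm hz _) (h.landsbergForm_symm hz _) ?_ ?_ ?_
  · ext i j
    exact h.finsler.fundTensor_symm hz j i
  · rw [hS X Y.1 hX, hSt]
  · rw [hS Y X.1 hY, hSt]
  · ext i j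
    have h1 := hL.curvature_sub he h.finsler hz X Y i j
    rw [heq, sub_self] at h1
    simp only [Matrix.sub_apply, Matrix.add_apply, Matrix.mul_apply, Matrix.of_apply,
      ← Finset.sum_add_distrib, ← Finset.sum_sub_distrib, Matrix.zero_apply]
    exact h1.symm

/-- Equality of the hh-curvatures makes the obstruction `u` vanish. -/
theorem SameHHCurvature.randersU_eq_zero (hcurv : D.SameHHCurvature D')
    (hL : D.IsMatsumotoL D' F) (hhor : D.HasCartanHorizontal F) (hmet : D.HMetrical F)
    (hn : 3 ≤ n) (he : e ∈ charts n M) {α β : Coord n × Coord n → ℝ}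
    (h : IsRandersPair e.target α β (inChart F e)) (hz : z ∈ natDomain e) (k : Fin n) :
    randersU α β (inChart F e) k z = 0 := by
  have hlift : ∀ ξ : Coord n, ∃ X : Coord n × Coord n, D.IsHorizontal e z X ∧ X.1 = ξ := fun ξ =>
    ⟨(ξ, WithLp.toLp 2 fun i => -∑ k, nonlinCoeff (inChart F e) i k z * ξ k),
      (hhor e he z hz _).2 fun i => rfl, rfl⟩
  refine h.randersU_eq_zero_of_commute hn hz (fun ξ η => ?_) k
  obtain ⟨X, hX, hXξ⟩ := hlift (WithLp.toLp 2 ξ)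
  obtain ⟨Y, hY, hYη⟩ := hlift (WithLp.toLp 2 η)
  have hc := hL.landsbergForm_comm hmet he h hz hX hY fun i j =>
    hcurv e he z hz X Y X Y hX hY ((hL.isHorizontal_iff he h hz X).2 hX)
      ((hL.isHorizontal_iff he h hz Y).2 hY) rfl rfl i j
  have hform : ∀ ξ : Coord n, (fundMatrix (inChart F e) z)⁻¹
      * (Matrix.of fun i j => ∑ k, landsberg (inChart F e) i j k z * ξ k)
      = landsbergForm (inChart F e) ξ z := fun ξ => by
    rw [← h.finsler.fundMatrix_mul_landsbergForm hz, ← mul_assoc,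
      Matrix.nonsing_inv_mul _ (h.finsler.isUnit_det hz), one_mul]
  rw [hXξ, hYη, h.finsler.fundMatrix_mul_landsbergForm hz,
    h.finsler.fundMatrix_mul_landsbergForm hz] at hc
  rw [← hform, ← hform] at hc
  exact hc

/-- The `L`-process of a Berwald metric is trivial. -/
theorem IsMatsumotoL.form_eq (hL : D.IsMatsumotoL D' F) (hB : IsBerwald F) (he : e ∈ charts n M)
    (h : IsLocalFinsler e.target (inChart F e)) (hz : z ∈ natDomain e) (X : Coord n × Coord n)
    (i j : Fin n) : D'.form e j i z X = D.form e j i z X := by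
  have h1 : ∀ i j k, landsberg (inChart F e) i j k z = 0 := fun i j k => by
    rw [h.landsberg_eq hz]
    simp [hB e he z hz]
  rw [hL e he z hz]
  simp [landsbergUp, h1]

end PullConnection

end CurvatureChange

end FinslerGeom

end

theorem mainTheorem3 (n : ℕ) (hn : 3 ≤ n)
    (M : Type*) [TopologicalSpace M] [ChartedSpace (FinslerGeom.Coord n) M]
    [IsManifold (𝓡 n) ∞ M]
    (F : TangentBundle (𝓡 n) M → ℝ) (hF : FinslerGeom.IsRanders F)
    (D D' : FinslerGeom.PullConnection n M)
    (hreg : D.IsRegular) (hhor : D.HasCartanHorizontal F)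
    (htor : D.HHTorsionFree) (hmet : D.HMetrical F)
    (hL : D.IsMatsumotoL D' F) :
    D.SameHHCurvature D' ↔ FinslerGeom.IsBerwald F := by
  constructor
  · intro hcurv e he z hz i j k l
    obtain ⟨α, β, h⟩ := hF.exists_isRandersPair he
    exact h.berwald_eq_zero hn
      (fun w hw m => hcurv.randersU_eq_zero hL hhor hmet hn he h hw m) hz i j k l
  · intro hB e he z hz X Y X' Y' hX hY hX' hY' hXX hYY i j
    obtain ⟨α, β, h⟩ := hF.exists_isRandersPair he
    -- A horizontal vector is determined by its projection, so that `X' = X` and `Y' = Y`.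
    have hlift : ∀ V V' : FinslerGeom.Coord n × FinslerGeom.Coord n, D.IsHorizontal e z V →
        D'.IsHorizontal e z V' → V'.1 = V.1 → V' = V := fun V V' hV hV' hVV => by
      have h1 := (hhor e he z hz V).1 hV
      have h2 := (hhor e he z hz V').1 ((hL.isHorizontal_iff he h hz V').1 hV')
      refine Prod.ext hVV ?_
      ext i
      rw [h1, h2, hVV]
    obtain rfl := hlift X X' hX hX' hXX
    obtain rfl := hlift Y Y' hY hY' hYY
    have hform : ∀ i j V, Set.EqOn (fun w => D'.form e j i w V) (fun w => D.form e j i w V)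
        (FinslerGeom.slitOver e.target) :=
      fun i j V w hw => hL.form_eq hB he h.finsler hw V i j
    have hval : ∀ i j V, D'.form e j i z V = D.form e j i z V := fun i j V => hform i j V hz
    simp only [FinslerGeom.PullConnection.curvature,
      FinslerGeom.fderiv_congr_of_eqOn h.isOpen_slit (hform i j _) hz, hval]
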